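/- Let $A>0$ be real (in particular, $A$ may be any positive integer) and $m\in(0,1)$. Let $\ell^{2,4}(\mathbb N_0)=\{c\in\ell^2(\mathbb N_0):\sum_n n^4|c_n|^2<\infty\}$, and let $T_o^{\pm},T_\infty^{\pm}:\ell^{2,4}(\mathbb N_0)\subset\ell^2(\mathbb N_0)\to\ell^2(\mathbb N_0)$ (complex sequences) be the semi-infinite tridiagonal operators $$(Tc)_0=r_0c_0+s_0c_1,\qquad (Tc)_n=p_nc_{n-1}+r_nc_n+s_nc_{n+1}\quad(n\ge1),$$ where $p_n,r_n,s_n$ are, respectively, - for $T_o^-$: $\frac m2(n-1)(2A+2n-1)$, $\;(1-\frac m2)\big((A+2n)^2-A^2\big)$, $\;\frac m2(n+1)(2A+2n+1)$; - for $T_o^+$: $-\frac m2 n(2A-2n+1)$, $\;(1-\frac m2)\big((2n+1-A)^2-A^2\big)$, $\;-\frac m2(n+1)(2A-2n-3)$; - for $T_\infty^-$: $-\frac m2(n-1)(2A-2n+1)$, $\;(1-\frac m2)\big((2n-A)^2-A^2\big)$, $\;-\frac m2(n+1)(2A-2n-1)$; - for $T_\infty^+$: $\frac m2 n(2A+2n-1)$,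 $\;(1-\frac m2)\big((2n+1+A)^2-A^2\big)$, $\;\frac m2(n+1)(2A+2n+3)$. (The equations $Tc=\lambda c$ are the recurrences for the coefficients of the Frobenius series $\zeta^{\rho}\sum_n c_n\zeta^{n}$ at $\zeta=0$ with $\rho=\frac A2$ for $T_o^-$ and $\rho=\frac{1-A}2$ for $T_o^+$, respectively $\zeta^{\rho}\sum_n c_n\zeta^{-n}$ at $\zeta=\infty$ with $\rho=\frac A2$ for $T_\infty^-$ and $\rho=-\frac{A+1}2$ for $T_\infty^+$, of solutions of the Heun equation $\zeta^2F y''+\zeta G y'+Hy=0$ with $F=-m\zeta^2+(2m-4)\zeta-m$, $G=-\frac32m\zeta^2+(2m-4)\zeta-\frac12m$, $H=\frac14A(A+1)m\zeta^2+(\lambda+A^2(1-\frac m2))\zeta+\frac14A(A-1)m$.) Let $\Sigma(T)$ be the set of $\lambda\in\mathbb C$ for which $Tc=\lambda c$ for some nonzero $c\in\ell^{2,4}(\mathbb N_0)$. Then, for each $T\in\{T_o^-,T_o^+,T_\infty^-,T_\infty^+\}$: 1. $T$ is closed and has compact resolvent. 2. Write $T=T_D+T_O$ with $T_D$ the diagonal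 and $T_O$ the off-diagonal part of $T$, let $P_n$ be the orthogonal projection of $\ell^2(\mathbb N_0)$ onto the span of the first $n$ canonical basis vectors $e_0,\dots,e_{n-1}$, and put $T_n=T_D+P_nT_O$ on $\ell^{2,4}(\mathbb N_0)$. Then the operators $T_n$ are closed and $T_n\to T$ in the generalized sense, i.e. the gap $\hat\delta(G(T_n),G(T))$ between the graphs in $\ell^2\times\ell^2$ tends to $0$, where $\hat\delta(M,N)=\max(\delta(M,N),\delta(N,M))$ and $\delta(M,N)=\sup\{\operatorname{dist}(u,N):u\in M,\ \|u\|=1\}$. 3. $\Sigma(T)\subset\mathbb R$. Moreover, if $\lambda\in\Sigma(T_o^-)\cup\Sigma(T_\infty^+)$, then $\lambda\ge0$. -/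

import Mathlib

open Filter Topology

noncomputable section

namespace HeunTridiagonal

/-- The complex Hilbert space `ℓ²(ℕ₀)` of square-summable sequences. -/
abbrev ell2 : Type := lp (fun _ : ℕ => ℂ) 2

/-! ### Closed operators: resolvent, eigenvalues, gap convergence -/

section General

variable {X Y : Type*} [NormedAddCommGroup X] [NormedSpace ℂ X]
  [NormedAddCommGroup Y] [NormedSpace ℂ Y]

/-- `S` is the (everywhere defined, bounded) resolvent `(T - z)⁻¹` of the operator `T`. -/
def IsResolventAt (T : X →ₗ.[ℂ] X) (z : ℂ) (S : X →L[ℂ] X) : Prop :=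
  (∀ y : X, ∃ h : S y ∈ T.domain, T ⟨S y, h⟩ - z • S y = y) ∧
    ∀ x : T.domain, S (T x - z • (x : X)) = (x : X)

/-- `T` has compact resolvent: its resolvent set is nonempty and `(T - z)⁻¹` is a compact
operator for every `z` in the resolvent set. -/
def HasCompactResolvent (T : X →ₗ.[ℂ] X) : Prop :=
  (∃ (z : ℂ) (S : X →L[ℂ] X), IsResolventAt T z S) ∧
    ∀ (z : ℂ) (S : X →L[ℂ] X), IsResolventAt T z S → IsCompactOperator S

/-- The set `Σ(T)` of eigenvalues of `T` (with eigenvectors in the domain of `T`). -/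
def eigenvalues (T : X →ₗ.[ℂ] X) : Set ℂ :=
  {z | ∃ x : T.domain, (x : X) ≠ 0 ∧ T x = z • (x : X)}

/-- `δ(M, N) = sup {dist (u, N) : u ∈ M, ‖u‖ = 1}` (it is `0` for `M = 0`). -/
def gapDelta (M N : Submodule ℂ X) : ℝ :=
  sSup ((fun u : X => Metric.infDist u (N : Set X)) '' {u : X | u ∈ M ∧ ‖u‖ = 1})

/-- The gap `δ̂(M, N) = max (δ(M, N), δ(N, M))` between two subspaces. -/
def gap (M N : Submodule ℂ X) : ℝ := max (gapDelta M N) (gapDelta N M)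

/-- The graph of `T` as a subspace of `X × Y` with the norm `(‖x‖² + ‖y‖²)^(1/2)`. -/
def graph₂ (T : X →ₗ.[ℂ] Y) : Submodule ℂ (WithLp 2 (X × Y)) :=
  T.graph.comap (WithLp.linearEquiv 2 ℂ (X × Y)).toLinearMap

/-- Convergence `Tₙ → T` in the generalized sense, in the space of closed operators: the gap
between the graphs tends to zero. -/
def ConvergesGeneralized (Tn : ℕ → (X →ₗ.[ℂ] Y)) (T : X →ₗ.[ℂ] Y) : Prop :=
  (∀ n, (Tn n).IsClosed) ∧ T.IsClosed ∧
    Tendsto (fun n => gap (graph₂ (Tn n)) (graph₂ T)) atTop (𝓝 0)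

end General

/-! ### Semi-infinite tridiagonal operators -/

lemma summable_succ_pow_four {c : ℕ → ℂ} (hc : Memℓp c 2)
    (h : Summable fun n : ℕ => (n : ℝ) ^ 4 * ‖c n‖ ^ 2) :
    Summable fun n : ℕ => ((n : ℝ) + 1) ^ 4 * ‖c n‖ ^ 2 := by
  have h0 : Summable fun n : ℕ => ‖c n‖ ^ 2 := by
    have := (memℓp_gen_iff (p := 2) (by norm_num)).1 hc
    simpa using this
  refine Summable.of_nonneg_of_le (fun n => by positivity) (fun n => ?_)
    ((h.add h0).mul_left 8)
  have h1 : ((n : ℝ) + 1) ^ 4 ≤ 8 * ((n : ℝ) ^ 4 + 1) := by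
    nlinarith [sq_nonneg ((n : ℝ) - 1), sq_nonneg ((n : ℝ) ^ 2 - 1),
      sq_nonneg ((n : ℝ) ^ 2 - n), sq_nonneg ((n : ℝ))]
  nlinarith [mul_le_mul_of_nonneg_right h1 (sq_nonneg ‖c n‖)]

lemma memℓp_of_growth {u d : ℕ → ℂ} {C : ℝ}
    (hd : Summable fun n : ℕ => ((n : ℝ) + 1) ^ 4 * ‖d n‖ ^ 2)
    (hu : ∀ n : ℕ, ‖u n‖ ≤ C * ((n : ℝ) + 1) ^ 2 * ‖d n‖) : Memℓp u 2 := by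
  refine (memℓp_gen_iff (p := 2) (by norm_num)).2 ?_
  have : Summable fun n : ℕ => ‖u n‖ ^ 2 := by
    refine Summable.of_nonneg_of_le (fun n => by positivity) (fun n => ?_) (hd.mul_left (C ^ 2))
    calc ‖u n‖ ^ 2 ≤ (C * ((n : ℝ) + 1) ^ 2 * ‖d n‖) ^ 2 :=
          pow_le_pow_left₀ (norm_nonneg _) (hu n) 2
      _ = C ^ 2 * (((n : ℝ) + 1) ^ 4 * ‖d n‖ ^ 2) := by ring
  simpa using this

/-- `ℓ^{2,4}(ℕ₀) = {c ∈ ℓ²(ℕ₀) : ∑ n⁴ |cₙ|² < ∞}`. -/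
def ell24 : Submodule ℂ ell2 where
  carrier := {c | Summable fun n : ℕ => (n : ℝ) ^ 4 * ‖c n‖ ^ 2}
  zero_mem' := by
    simp [summable_zero]
  add_mem' := by
    intro a b ha hb
    refine Summable.of_nonneg_of_le (fun n => by positivity) (fun n => ?_)
      ((ha.add hb).mul_left 2)
    have h1 : ‖(a + b) n‖ ≤ ‖a n‖ + ‖b n‖ := norm_add_le _ _
    have h2 : ‖(a + b) n‖ ^ 2 ≤ 2 * (‖a n‖ ^ 2 + ‖b n‖ ^ 2) := by
      nlinarith [norm_nonneg ((a + b) n), sq_nonneg (‖a n‖ - ‖b n‖)]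
    have h3 : (0 : ℝ) ≤ (n : ℝ) ^ 4 := by positivity
    nlinarith [mul_le_mul_of_nonneg_left h2 h3]
  smul_mem' := by
    intro z c hc
    refine (hc.mul_left (‖z‖ ^ 2)).congr (fun n => ?_)
    have : ‖(z • c) n‖ = ‖z‖ * ‖c n‖ := norm_smul z (c n)
    rw [this]; ring

/-- A semi-infinite real tridiagonal matrix, with rows `n = 0, 1, 2, …`, whose entries grow at
most quadratically. Row `n` has the entry `sub n` in column `n - 1` (for `n ≥ 1`; `sub 0` is not
an entry of the matrix), `diag n` in column `n` and `sup n` in column `n + 1`. -/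
structure TridiagMatrix where
  sub : ℕ → ℝ
  diag : ℕ → ℝ
  sup : ℕ → ℝ
  sub_growth : ∃ C : ℝ, ∀ n : ℕ, |sub n| ≤ C * ((n : ℝ) + 1) ^ 2
  diag_growth : ∃ C : ℝ, ∀ n : ℕ, |diag n| ≤ C * ((n : ℝ) + 1) ^ 2
  sup_growth : ∃ C : ℝ, ∀ n : ℕ, |sup n| ≤ C * ((n : ℝ) + 1) ^ 2

namespace TridiagMatrix

variable (M : TridiagMatrix)

/-- The part of the matrix-vector product that comes from the subdiagonal. -/
def subSeq (c : ℕ → ℂ) : ℕ → ℂ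
  | 0 => 0
  | n + 1 => (M.sub (n + 1) : ℂ) * c n

/-- The part of the matrix-vector product that comes from the diagonal. -/
def diagSeq (c : ℕ → ℂ) (n : ℕ) : ℂ := (M.diag n : ℂ) * c n

/-- The part of the matrix-vector product that comes from the superdiagonal. -/
def supSeq (c : ℕ → ℂ) (n : ℕ) : ℂ := (M.sup n : ℂ) * c (n + 1)

/-- The matrix-vector product. -/
def mulSeq (c : ℕ → ℂ) (n : ℕ) : ℂ := M.subSeq c n + M.diagSeq c n + M.supSeq c n

lemma memℓp_diagSeq (c : ell24) : Memℓp (M.diagSeq (c : ell2)) 2 := by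
  obtain ⟨C, hC⟩ := M.diag_growth
  refine memℓp_of_growth (C := C) (summable_succ_pow_four (lp.memℓp _) c.2) (fun n => ?_)
  simp only [diagSeq, norm_mul, Complex.norm_real, Real.norm_eq_abs]
  exact mul_le_mul_of_nonneg_right (hC n) (norm_nonneg _)

lemma memℓp_supSeq (c : ell24) : Memℓp (M.supSeq (c : ell2)) 2 := by
  obtain ⟨C, hC⟩ := M.sup_growth
  have h := summable_succ_pow_four (lp.memℓp _) c.2
  refine memℓp_of_growth (d := fun n => (c : ell2) (n + 1)) (C := C) ?_ (fun n => ?_)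
  · refine Summable.of_nonneg_of_le (fun n => by positivity) (fun n => ?_)
      ((summable_nat_add_iff 1).2 h)
    refine mul_le_mul_of_nonneg_right (pow_le_pow_left₀ (by positivity) ?_ 4) (by positivity)
    push_cast; linarith
  · simp only [supSeq, norm_mul, Complex.norm_real, Real.norm_eq_abs]
    exact mul_le_mul_of_nonneg_right (hC n) (norm_nonneg _)

lemma memℓp_subSeq (c : ell24) : Memℓp (M.subSeq (c : ell2)) 2 := by
  obtain ⟨C, hC⟩ := M.sub_growth
  have h := summable_succ_pow_four (lp.memℓp _) c.2
  refine memℓp_of_growth (d := fun n => if n = 0 then 0 else (c : ell2) (n - 1)) (C := C) ?_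
    (fun n => ?_)
  · refine (summable_nat_add_iff 1).1 ?_
    refine Summable.of_nonneg_of_le (fun n => by positivity) (fun n => ?_) (h.mul_left 16)
    have h1 : ((((n + 1 : ℕ) : ℝ)) + 1) ^ 4 ≤ 16 * ((n : ℝ) + 1) ^ 4 := by
      have h2 : ((n + 1 : ℕ) : ℝ) + 1 ≤ 2 * ((n : ℝ) + 1) := by
        push_cast; linarith [(Nat.cast_nonneg n : (0 : ℝ) ≤ n)]
      calc _ ≤ (2 * ((n : ℝ) + 1)) ^ 4 := pow_le_pow_left₀ (by positivity) h2 4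
        _ = _ := by ring
    simp only [Nat.add_eq_zero_iff, one_ne_zero, and_false, if_false, Nat.add_sub_cancel]
    rw [← mul_assoc]
    exact mul_le_mul_of_nonneg_right h1 (by positivity)
  · cases n with
    | zero => simp [subSeq]
    | succ n =>
      simp only [subSeq, norm_mul, Complex.norm_real, Real.norm_eq_abs, Nat.add_eq_zero_iff,
        one_ne_zero, and_false, if_false, Nat.add_sub_cancel]
      exact mul_le_mul_of_nonneg_right (hC (n + 1)) (norm_nonneg _)

/-- The operator `T : ℓ^{2,4}(ℕ₀) ⊂ ℓ²(ℕ₀) → ℓ²(ℕ₀)` given by a tridiagonal matrix. -/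
def op : ell2 →ₗ.[ℂ] ell2 where
  domain := ell24
  toFun :=
    { toFun := fun c => ⟨M.mulSeq (c : ell2),
        ((M.memℓp_subSeq c).add (M.memℓp_diagSeq c)).add (M.memℓp_supSeq c)⟩
      map_add' := by
        intro a b
        ext n
        change M.mulSeq (fun k => (a : ell2) k + (b : ell2) k) n =
          M.mulSeq (a : ell2) n + M.mulSeq (b : ell2) n
        cases n <;> simp only [mulSeq, subSeq, diagSeq, supSeq] <;> ring
      map_smul' := by
        intro z c
        ext n
        change M.mulSeq (fun k => z * (c : ell2) k) n = z * M.mulSeq (c : ell2) n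
        cases n <;> simp only [mulSeq, subSeq, diagSeq, supSeq] <;> ring }

/-- The diagonal part of a tridiagonal matrix. -/
def diagPart : TridiagMatrix where
  sub := fun _ => 0
  diag := M.diag
  sup := fun _ => 0
  sub_growth := ⟨0, by simp⟩
  diag_growth := M.diag_growth
  sup_growth := ⟨0, by simp⟩

/-- The off-diagonal part of a tridiagonal matrix. -/
def offDiagPart : TridiagMatrix where
  sub := M.sub
  diag := fun _ => 0
  sup := M.sup
  sub_growth := M.sub_growth
  diag_growth := ⟨0, by simp⟩
  sup_growth := M.sup_growth

end TridiagMatrix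

/-- The span of the canonical basis vectors `e₀, …, e_{n-1}` of `ℓ²(ℕ₀)`. -/
def basisSpan (n : ℕ) : Submodule ℂ ell2 :=
  Submodule.span ℂ (Set.range fun i : Fin n => (lp.single 2 (i : ℕ) (1 : ℂ) : ell2))

instance (n : ℕ) : FiniteDimensional ℂ (basisSpan n) :=
  FiniteDimensional.span_of_finite ℂ (Set.finite_range _)

/-- The operator `Tₙ = T_D + Pₙ T_O` with domain `ℓ^{2,4}(ℕ₀)`, where `T_D` and `T_O` are the
diagonal and the off-diagonal part of `T`, and `Pₙ` is the orthogonal projection of `ℓ²(ℕ₀)`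
onto the span of `e₀, …, e_{n-1}`. -/
def TridiagMatrix.truncOp (M : TridiagMatrix) (n : ℕ) : ell2 →ₗ.[ℂ] ell2 :=
  M.diagPart.op + (basisSpan n).starProjection.toLinearMap.compPMap M.offDiagPart.op

/-! ### The four tridiagonal operators of the Heun equation -/

lemma quadratic_growth (f : ℕ → ℝ) (a b d : ℝ)
    (hf : ∀ n : ℕ, f n = a + b * n + d * (n : ℝ) ^ 2) :
    ∃ C : ℝ, ∀ n : ℕ, |f n| ≤ C * ((n : ℝ) + 1) ^ 2 := by
  refine ⟨|a| + |b| + |d|, fun n => ?_⟩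
  have hn : (0 : ℝ) ≤ n := Nat.cast_nonneg n
  rw [hf n]
  have h1 : |a + b * n + d * (n : ℝ) ^ 2| ≤ |a| + |b| * n + |d| * (n : ℝ) ^ 2 := by
    refine (abs_add_le _ _).trans (add_le_add ((abs_add_le _ _).trans (add_le_add le_rfl ?_)) ?_)
    · rw [abs_mul, abs_of_nonneg hn]
    · rw [abs_mul, abs_of_nonneg (sq_nonneg (n : ℝ))]
  have ha := abs_nonneg a
  have hb := abs_nonneg b
  have hd := abs_nonneg d
  have h2 : (0 : ℝ) ≤ |a| * ((n : ℝ) ^ 2 + 2 * n) := by positivity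
  have h3 : (0 : ℝ) ≤ |b| * ((n : ℝ) ^ 2 + n + 1) := by positivity
  have h4 : (0 : ℝ) ≤ |d| * (2 * n + 1) := by positivity
  nlinarith

/-- The matrix of `T_o^-`, from the recurrence at `ζ = 0` with Frobenius exponent `A / 2`. -/
def matOMinus (A m : ℝ) : TridiagMatrix where
  sub n := m / 2 * ((n : ℝ) - 1) * (2 * A + 2 * n - 1)
  diag n := (1 - m / 2) * ((A + 2 * n) ^ 2 - A ^ 2)
  sup n := m / 2 * ((n : ℝ) + 1) * (2 * A + 2 * n + 1)
  sub_growth := quadratic_growth _ (m / 2 * (1 - 2 * A)) (m / 2 * (2 * A - 3)) m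
    (fun n => by ring)
  diag_growth := quadratic_growth _ 0 ((1 - m / 2) * (4 * A)) ((1 - m / 2) * 4)
    (fun n => by ring)
  sup_growth := quadratic_growth _ (m / 2 * (2 * A + 1)) (m / 2 * (2 * A + 3)) m
    (fun n => by ring)

/-- The matrix of `T_o^+`, from the recurrence at `ζ = 0` with Frobenius exponent
`-(A - 1) / 2`. -/
def matOPlus (A m : ℝ) : TridiagMatrix where
  sub n := -(m / 2) * n * (2 * A - 2 * n + 1)
  diag n := (1 - m / 2) * ((2 * n + 1 - A) ^ 2 - A ^ 2)
  sup n := -(m / 2) * ((n : ℝ) + 1) * (2 * A - 2 * n - 3)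
  sub_growth := quadratic_growth _ 0 (-(m / 2) * (2 * A + 1)) m (fun n => by ring)
  diag_growth := quadratic_growth _ ((1 - m / 2) * (1 - 2 * A)) ((1 - m / 2) * (4 - 4 * A))
    ((1 - m / 2) * 4) (fun n => by ring)
  sup_growth := quadratic_growth _ (-(m / 2) * (2 * A - 3)) (-(m / 2) * (2 * A - 5)) m
    (fun n => by ring)

/-- The matrix of `T_∞^-`, from the recurrence at `ζ = ∞` with Frobenius exponent `A / 2`. -/
def matInftyMinus (A m : ℝ) : TridiagMatrix where
  sub n := -(m / 2) * ((n : ℝ) - 1) * (2 * A - 2 * n + 1)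
  diag n := (1 - m / 2) * ((2 * n - A) ^ 2 - A ^ 2)
  sup n := -(m / 2) * ((n : ℝ) + 1) * (2 * A - 2 * n - 1)
  sub_growth := quadratic_growth _ (m / 2 * (2 * A + 1)) (-(m / 2) * (2 * A + 3)) m
    (fun n => by ring)
  diag_growth := quadratic_growth _ 0 (-(1 - m / 2) * (4 * A)) ((1 - m / 2) * 4)
    (fun n => by ring)
  sup_growth := quadratic_growth _ (-(m / 2) * (2 * A - 1)) (-(m / 2) * (2 * A - 3)) m
    (fun n => by ring)

/-- The matrix of `T_∞^+`, from the recurrence at `ζ = ∞` with Frobenius exponent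
`-(A + 1) / 2`. -/
def matInftyPlus (A m : ℝ) : TridiagMatrix where
  sub n := m / 2 * n * (2 * A + 2 * n - 1)
  diag n := (1 - m / 2) * ((2 * n + 1 + A) ^ 2 - A ^ 2)
  sup n := m / 2 * ((n : ℝ) + 1) * (2 * A + 2 * n + 3)
  sub_growth := quadratic_growth _ 0 (m / 2 * (2 * A - 1)) m (fun n => by ring)
  diag_growth := quadratic_growth _ ((1 - m / 2) * (1 + 2 * A)) ((1 - m / 2) * (4 + 4 * A))
    ((1 - m / 2) * 4) (fun n => by ring)
  sup_growth := quadratic_growth _ (m / 2 * (2 * A + 3)) (m / 2 * (2 * A + 5)) m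
    (fun n => by ring)

end HeunTridiagonal

end

noncomputable section

namespace HeunTridiagonal

/-! ### Resolvents, closedness and the gap -/

section Resolvent

/-! Two independent mechanisms carry the theorem.

Closedness, compact resolvent and gap convergence come from a relative perturbation of the diagonal.
The diagonal grows like `(4 - 2m) n²` and each off-diagonal like `m n²`. Since `2m < 4 - 2m`, for a
sufficiently negative real `z` each off-diagonal entry is at most `q < 1/2` times the entry of `T_D
- z` in its column (`exists_dominatedAt`). With `R = (T_D - z)⁻¹` and `K = T_O R` this gives `‖K‖ ≤
2q < 1` and `T - z = (1 + K) R⁻¹`, so `R (1 + K)⁻¹` is a resolvent, compact because `R` is. Likewise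
`T_n - z = (1 + P_n K) R⁻¹`. The difference of the resolvents is `R (1 + K)⁻¹ (1 - P_n) K (1 + P_n
K)⁻¹`. It tends to zero in norm, because a compact operator absorbs the strong convergence `P_n →
1`; norm convergence of resolvents bounds the gap (`gapDelta_graph₂_le`).

Reality of eigenvalues comes from a factorization `T = J W` with `J` real symmetric tridiagonal and
`W` real diagonal (`IsFactored`). Pairing `T c = z c` with `W c` gives `z ⟨Wc, c⟩ = ⟨Wc, J W c⟩`,
with both pairings real (`mul_tsum_weight_eq`). If `⟨Wc, c⟩ ≠ 0`, then `z` is real. If it vanishes,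
then either `W ≥ 0` or the definiteness of `J` forces `W c = 0`, hence `T c = 0` and `z = 0`. When
`W ≥ 0` and the form of `J` is nonnegative, so is `z`. -/

lemma norm_toLp_sq {X : Type*} [NormedAddCommGroup X] (a b : X) :
    ‖WithLp.toLp 2 (a, b)‖ ^ 2 = ‖a‖ ^ 2 + ‖b‖ ^ 2 :=
  WithLp.prod_norm_sq_eq_of_L2 _

variable {X : Type*} [NormedAddCommGroup X] [NormedSpace ℂ X]

/-- The graph is the set where two continuous maps agree, `S (y - z x) = x`. -/
lemma IsResolventAt.isClosed {T : X →ₗ.[ℂ] X} {z : ℂ} {S : X →L[ℂ] X}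
    (h : IsResolventAt T z S) : T.IsClosed := by
  have hset : (T.graph : Set (X × X)) = {p | S (p.2 - z • p.1) = p.1} := by
    ext ⟨x, y⟩
    simp only [SetLike.mem_coe, LinearPMap.mem_graph_iff', Set.mem_ofPred_eq, Prod.mk.injEq]
    constructor
    · rintro ⟨w, rfl, rfl⟩
      exact h.2 w
    · intro hx
      obtain ⟨hd, he⟩ := h.1 (y - z • x)
      simp only [hx] at hd he
      exact ⟨⟨x, hd⟩, rfl, sub_left_injective he⟩
  rw [LinearPMap.IsClosed, hset]
  exact isClosed_eq (by fun_prop) (by fun_prop)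

/-- The first resolvent identity. It transfers compactness from one point of the resolvent set to
all others. -/
lemma IsResolventAt.eq_comp {T : X →ₗ.[ℂ] X} {z w : ℂ} {S S' : X →L[ℂ] X}
    (h : IsResolventAt T z S) (h' : IsResolventAt T w S') :
    S' = S ∘L (ContinuousLinearMap.id ℂ X + (w - z) • S') := by
  ext y
  obtain ⟨hd, he⟩ := h'.1 y
  have h2 := h.2 ⟨S' y, hd⟩
  have h3 : y + (w - z) • S' y = T ⟨S' y, hd⟩ - z • S' y := by
    nth_rewrite 1 [← he]
    rw [sub_smul]; abel
  rw [← h3] at h2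
  simpa using h2.symm

lemma IsResolventAt.hasCompactResolvent {T : X →ₗ.[ℂ] X} {z : ℂ} {S : X →L[ℂ] X}
    (h : IsResolventAt T z S) (hS : IsCompactOperator S) : HasCompactResolvent T := by
  refine ⟨⟨z, S, h⟩, fun w S' h' => ?_⟩
  rw [h.eq_comp h']
  exact hS.comp_clm _

/-- The hypotheses encode `T - z = B R⁻¹` on the range of `R`, which contains the whole domain;
inverting `B` then inverts `T - z`. -/
lemma isResolventAt_comp {T : X →ₗ.[ℂ] X} {z : ℂ} {R B U : X →L[ℂ] X}
    (hR : ∀ f, ∃ h : R f ∈ T.domain, T ⟨R f, h⟩ - z • R f = B f)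
    (hsurj : ∀ x ∈ T.domain, ∃ f, R f = x)
    (hBU : ∀ f, B (U f) = f) (hUB : ∀ f, U (B f) = f) : IsResolventAt T z (R ∘L U) := by
  refine ⟨fun y => ?_, ?_⟩
  · obtain ⟨h, he⟩ := hR (U y)
    exact ⟨h, he.trans (hBU y)⟩
  · rintro ⟨x, hx⟩
    obtain ⟨f, rfl⟩ := hsurj x hx
    obtain ⟨h, he⟩ := hR f
    simp only [ContinuousLinearMap.comp_apply]
    rw [he, hUB]

lemma mem_graph₂ {T : X →ₗ.[ℂ] X} (x : T.domain) :
    WithLp.toLp 2 ((x : X), T x) ∈ graph₂ T := by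
  simp [graph₂]

lemma norm_toLp_le {X : Type*} [NormedAddCommGroup X] (a b : X) : ‖WithLp.toLp 2 (a, b)‖ ≤ ‖a‖ + ‖b‖ := by
  refine abs_le_of_sq_le_sq' ?_ (by positivity) |>.2
  rw [norm_toLp_sq]
  nlinarith [norm_nonneg a, norm_nonneg b]

lemma gapDelta_nonneg (M N : Submodule ℂ X) : 0 ≤ gapDelta M N :=
  Real.sSup_nonneg (by rintro _ ⟨u, -, rfl⟩; exact Metric.infDist_nonneg)

/-- A unit vector `(x, T x)` is compared with the point of the other graph over `S' y`, where `y =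
(T - z) x`. With `d = (S - S') y` the difference is `(d, z d)`. One factor `1 + ‖z‖` bounds `‖y‖`,
the other the norm of this pair. -/
lemma gapDelta_graph₂_le {T T' : X →ₗ.[ℂ] X} {z : ℂ} {S S' : X →L[ℂ] X}
    (h : IsResolventAt T z S) (h' : IsResolventAt T' z S') :
    gapDelta (graph₂ T) (graph₂ T') ≤ (1 + ‖z‖) ^ 2 * ‖S - S'‖ := by
  refine Real.sSup_le ?_ (by positivity)
  rintro _ ⟨u, ⟨hu, hu1⟩, rfl⟩
  obtain ⟨⟨a, b⟩⟩ := u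
  obtain ⟨x, hx⟩ := (LinearPMap.mem_graph_iff' T).1 hu
  simp only [WithLp.linearEquiv] at hx
  obtain ⟨rfl, rfl⟩ : (x : X) = a ∧ T x = b := by simpa using hx
  set y := T x - z • (x : X) with hy
  have hSy : S y = x := h.2 x
  obtain ⟨hd, he⟩ := h'.1 y
  have hsq := norm_toLp_sq (x : X) (T x)
  rw [hu1] at hsq
  have hx1 : ‖(x : X)‖ ≤ 1 := by nlinarith [sq_nonneg ‖T x‖, norm_nonneg (x : X)]
  have hT1 : ‖T x‖ ≤ 1 := by nlinarith [sq_nonneg ‖(x : X)‖, norm_nonneg (T x)]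
  have hyn : ‖y‖ ≤ 1 + ‖z‖ := by
    refine (norm_sub_le _ _).trans (add_le_add hT1 ?_)
    rw [norm_smul]
    exact mul_le_of_le_one_right (norm_nonneg _) hx1
  refine (Metric.infDist_le_dist_of_mem (mem_graph₂ (T := T') ⟨S' y, hd⟩)).trans ?_
  rw [dist_eq_norm, ← WithLp.toLp_sub, Prod.mk_sub_mk]
  have h1 : (x : X) - S' y = (S - S') y := by simp [hSy]
  have h2 : T x - T' ⟨S' y, hd⟩ = z • (S - S') y := by
    rw [← h1, smul_sub, sub_eq_sub_iff_sub_eq_sub, ← hy]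
    exact he.symm
  simp only [h1, h2]
  refine (norm_toLp_le _ _).trans ?_
  rw [norm_smul]
  have h3 : ‖(S - S') y‖ ≤ ‖S - S'‖ * (1 + ‖z‖) :=
    ((S - S').le_opNorm y).trans (mul_le_mul_of_nonneg_left hyn (norm_nonneg _))
  have hz := norm_nonneg z
  nlinarith

lemma convergesGeneralized_of_resolvent {T : X →ₗ.[ℂ] X} {Tn : ℕ → X →ₗ.[ℂ] X} {z : ℂ}
    {S : X →L[ℂ] X} {Sn : ℕ → X →L[ℂ] X} (h : IsResolventAt T z S)
    (hn : ∀ n, IsResolventAt (Tn n) z (Sn n))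
    (hlim : Tendsto (fun n => ‖Sn n - S‖) atTop (𝓝 0)) : ConvergesGeneralized Tn T := by
  refine ⟨fun n => (hn n).isClosed, h.isClosed, ?_⟩
  refine squeeze_zero (fun n => le_max_of_le_left (gapDelta_nonneg _ _)) (fun n => ?_)
    (by simpa using hlim.const_mul ((1 + ‖z‖) ^ 2))
  refine max_le (gapDelta_graph₂_le (hn n) h) ?_
  rw [norm_sub_rev]
  exact gapDelta_graph₂_le h (hn n)

/-- Neumann series; the explicit bound makes the inverses uniform in `n` when applied to `P_n K`. -/
lemma exists_inverse_one_add [CompleteSpace X] (K : X →L[ℂ] X) {q : ℝ} (hK : ‖K‖ ≤ q)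
    (hq : q < 1) :
    ∃ U : X →L[ℂ] X, (1 + K) * U = 1 ∧ U * (1 + K) = 1 ∧ ‖U‖ ≤ (1 - q)⁻¹ := by
  have hu : IsUnit (1 + K) := by
    have := (Units.oneSub (-K) (by rw [norm_neg]; linarith)).isUnit
    rwa [Units.val_oneSub, sub_neg_eq_add] at this
  obtain ⟨u, hu⟩ := hu
  refine ⟨(u⁻¹ : (X →L[ℂ] X)ˣ), by rw [← hu]; simp, by rw [← hu]; simp, ?_⟩
  refine ContinuousLinearMap.opNorm_le_bound _ (inv_nonneg.2 (by linarith)) fun x => ?_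
  set y := (u⁻¹ : (X →L[ℂ] X)ˣ).val x with hy
  have hx : x = y + K y := by
    have : ((1 + K) * (u⁻¹ : (X →L[ℂ] X)ˣ).val) x = x := by rw [← hu]; simp
    simpa using this.symm
  have h1 : ‖y‖ ≤ ‖x‖ + ‖K y‖ := by
    calc ‖y‖ = ‖x - K y‖ := by rw [hx]; simp
      _ ≤ _ := norm_sub_le _ _
  have h2 : ‖K y‖ ≤ q * ‖y‖ :=
    (K.le_opNorm y).trans (mul_le_mul_of_nonneg_right hK (norm_nonneg _))
  rw [inv_mul_eq_div, le_div_iff₀ (by linarith)]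
  linarith

/-- Strong convergence to zero becomes norm convergence after composition with a compact
operator. -/
lemma tendsto_norm_comp_of_isCompactOperator {Q : ℕ → X →L[ℂ] X} (hQ : ∀ n, ‖Q n‖ ≤ 1)
    (hlim : ∀ x, Tendsto (fun n => Q n x) atTop (𝓝 0)) {C : X →L[ℂ] X}
    (hC : IsCompactOperator C) : Tendsto (fun n => ‖Q n ∘L C‖) atTop (𝓝 0) := by
  rw [Metric.tendsto_atTop]
  intro ε hε
  obtain ⟨L, hL, hsub⟩ := hC.image_closedBall_subset_compact (𝕜₁ := ℂ) (f := (C : X →ₗ[ℂ] X)) 1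
  -- A finite `ε / 3`-net of the image of the unit ball: `Q n` is uniformly small on the net, and
  -- `‖Q n‖ ≤ 1` handles the distance to it.
  obtain ⟨t, ht, hcov⟩ := Metric.totallyBounded_iff.1 hL.totallyBounded (ε / 3) (by positivity)
  have hev : ∀ᶠ n in atTop, ∀ y ∈ t, ‖Q n y‖ < ε / 3 :=
    (ht.eventually_all).2 fun y _ => by
      simpa using (hlim y).norm.eventually_lt_const (by simpa using (by positivity : 0 < ε / 3))
  obtain ⟨N, hN⟩ := eventually_atTop.1 hev
  refine ⟨N, fun n hn => ?_⟩
  rw [Real.dist_0_eq_abs, abs_norm]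
  refine lt_of_le_of_lt (b := 2 * ε / 3) ?_ (by linarith)
  refine ContinuousLinearMap.opNorm_le_of_unit_norm (𝕜 := ℂ) (by positivity) fun x hx => ?_
  have hmem : C x ∈ L := hsub ⟨x, by simp [hx], rfl⟩
  obtain ⟨y, hy, hxy⟩ := Set.mem_iUnion₂.1 (hcov hmem)
  have h1 : ‖Q n (C x - y)‖ ≤ ε / 3 := by
    refine ((Q n).le_opNorm _).trans ?_
    rw [Metric.mem_ball, dist_eq_norm] at hxy
    nlinarith [hQ n, norm_nonneg (C x - y), norm_nonneg (Q n)]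
  calc ‖Q n (C x)‖ = ‖Q n (C x - y) + Q n y‖ := by simp
    _ ≤ _ := norm_add_le _ _
    _ ≤ 2 * ε / 3 := by linarith [hN n hn y hy]

end Resolvent

/-! ### Bounded operators on `ℓ²` -/

section BoundedOperators

lemma norm_sq_eq_tsum (f : ell2) : ‖f‖ ^ 2 = ∑' n, ‖f n‖ ^ 2 := by
  have := lp.norm_rpow_eq_tsum (p := 2) (by norm_num) f
  simpa using this

lemma summable_norm_sq (f : ell2) : Summable fun n => ‖f n‖ ^ 2 := by
  have := (memℓp_gen_iff (p := 2) (by norm_num)).1 (lp.memℓp f)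
  simpa using this

lemma memℓp_two_of_summable {f : ℕ → ℂ} (h : Summable fun n => ‖f n‖ ^ 2) : Memℓp f 2 := by
  refine (memℓp_gen_iff (p := 2) (by norm_num)).2 ?_
  simpa using h

lemma norm_le_of_forall_norm_le {f g : ell2} {C : ℝ} (hC : 0 ≤ C)
    (h : ∀ n, ‖g n‖ ≤ C * ‖f n‖) : ‖g‖ ≤ C * ‖f‖ := by
  refine abs_le_of_sq_le_sq' ?_ (by positivity) |>.2
  rw [mul_pow, norm_sq_eq_tsum, norm_sq_eq_tsum, ← tsum_mul_left]
  refine (summable_norm_sq g).tsum_le_tsum (fun n => ?_) ((summable_norm_sq f).mul_left _)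
  rw [← mul_pow]
  exact pow_le_pow_left₀ (norm_nonneg _) (h n) 2

lemma memℓp_bounded_mul {a : ℕ → ℂ} {C : ℝ} (ha : ∀ n, ‖a n‖ ≤ C) (f : ell2) :
    Memℓp (fun n => a n * f n) 2 := by
  refine memℓp_two_of_summable (Summable.of_nonneg_of_le (fun n => by positivity) (fun n => ?_)
    ((summable_norm_sq f).mul_left (C ^ 2)))
  rw [norm_mul, mul_pow]
  gcongr
  exact ha n

/-- Multiplication by a bounded sequence. -/
def diagCLM (a : ℕ → ℂ) (C : ℝ) (ha : ∀ n, ‖a n‖ ≤ C) : ell2 →L[ℂ] ell2 :=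
  LinearMap.mkContinuous
    { toFun := fun f => ⟨fun n => a n * f n, memℓp_bounded_mul ha f⟩
      map_add' := by
        intro f g
        ext n
        exact mul_add (a n) (f n) (g n)
      map_smul' := by
        intro z f
        ext n
        exact mul_left_comm (a n) z (f n) } C
    (fun f => norm_le_of_forall_norm_le ((norm_nonneg _).trans (ha 0)) fun n => by
      change ‖a n * f n‖ ≤ _
      rw [norm_mul]
      exact mul_le_mul_of_nonneg_right (ha n) (norm_nonneg _))

@[simp]
lemma diagCLM_apply (a : ℕ → ℂ) (C : ℝ) (ha : ∀ n, ‖a n‖ ≤ C) (f : ell2) (n : ℕ) :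
    diagCLM a C ha f n = a n * f n := rfl

lemma norm_diagCLM_le (a : ℕ → ℂ) (C : ℝ) (ha : ∀ n, ‖a n‖ ≤ C) : ‖diagCLM a C ha‖ ≤ C :=
  LinearMap.mkContinuous_norm_le _ ((norm_nonneg _).trans (ha 0)) _

/-- The right shift of a sequence. -/
def shiftRightSeq (f : ℕ → ℂ) : ℕ → ℂ
  | 0 => 0
  | n + 1 => f n

lemma summable_shiftRightSeq (f : ell2) : Summable fun n => ‖shiftRightSeq f n‖ ^ 2 :=
  (summable_nat_add_iff 1).1 (summable_norm_sq f)

/-- The right shift on `ℓ²`. -/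
def shiftRight : ell2 →L[ℂ] ell2 :=
  LinearMap.mkContinuous
    { toFun := fun f => ⟨shiftRightSeq f, memℓp_two_of_summable (summable_shiftRightSeq f)⟩
      map_add' := by
        intro f g
        ext n
        cases n with
        | zero => exact (add_zero (0 : ℂ)).symm
        | succ n => rfl
      map_smul' := by
        intro z f
        ext n
        cases n with
        | zero => exact (mul_zero z).symm
        | succ n => rfl } 1
    (fun f => by
      rw [one_mul]
      refine abs_le_of_sq_le_sq' ?_ (norm_nonneg _) |>.2
      rw [norm_sq_eq_tsum, norm_sq_eq_tsum]
      change ∑' n, ‖shiftRightSeq f n‖ ^ 2 ≤ _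
      rw [(summable_shiftRightSeq f).tsum_eq_zero_add]
      simp [shiftRightSeq])

/-- The left shift on `ℓ²`. -/
def shiftLeft : ell2 →L[ℂ] ell2 :=
  LinearMap.mkContinuous
    { toFun := fun f => ⟨fun n => f (n + 1),
        memℓp_two_of_summable ((summable_nat_add_iff 1).2 (summable_norm_sq f))⟩
      map_add' := fun _ _ => rfl
      map_smul' := fun _ _ => rfl } 1
    (fun f => by
      rw [one_mul]
      refine abs_le_of_sq_le_sq' ?_ (norm_nonneg _) |>.2
      rw [norm_sq_eq_tsum, norm_sq_eq_tsum, (summable_norm_sq f).tsum_eq_zero_add]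
      change ∑' n, ‖f (n + 1)‖ ^ 2 ≤ _
      exact le_add_of_nonneg_left (by positivity))

@[simp]
lemma shiftRight_apply_zero (f : ell2) : shiftRight f 0 = 0 := rfl

@[simp]
lemma shiftRight_apply_succ (f : ell2) (n : ℕ) : shiftRight f (n + 1) = f n := rfl

@[simp]
lemma shiftLeft_apply (f : ell2) (n : ℕ) : shiftLeft f n = f (n + 1) := rfl

lemma norm_shiftRight_le : ‖shiftRight‖ ≤ 1 :=
  LinearMap.mkContinuous_norm_le _ zero_le_one _

lemma norm_shiftLeft_le : ‖shiftLeft‖ ≤ 1 :=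
  LinearMap.mkContinuous_norm_le _ zero_le_one _

lemma sum_single_apply (s : Finset ℕ) (f : ell2) (k : ℕ) :
    (∑ i ∈ s, lp.single 2 i (f i) : ell2) k = if k ∈ s then f k else 0 := by
  rw [lp.coeFn_sum]
  refine (Finset.sum_apply k _ _).trans ?_
  simp [Pi.single_apply]

lemma starProjection_basisSpan (n : ℕ) (f : ell2) :
    (basisSpan n).starProjection f = ∑ i ∈ Finset.range n, lp.single 2 i (f i) := by
  refine Submodule.eq_starProjection_of_mem_of_inner_eq_zero (K := basisSpan n) ?_ ?_
  · refine Submodule.sum_mem _ fun i hi => ?_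
    have : (lp.single 2 i (f i) : ell2) = f i • lp.single 2 i (1 : ℂ) := by
      rw [← lp.single_smul]; simp
    rw [this]
    exact Submodule.smul_mem _ _ (Submodule.subset_span ⟨⟨i, Finset.mem_range.1 hi⟩, rfl⟩)
  · intro w hw
    induction hw using Submodule.span_induction with
    | mem x hx =>
      obtain ⟨j, rfl⟩ := hx
      refine (lp.inner_single_right (𝕜 := ℂ) (G := fun _ : ℕ => ℂ) (j : ℕ) (1 : ℂ) _).trans ?_
      rw [lp.coeFn_sub, Pi.sub_apply, sum_single_apply]
      simp
    | zero => simp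
    | add x y _ _ hx hy => rw [inner_add_right, hx, hy, add_zero]
    | smul a x _ hx => rw [inner_smul_right, hx, mul_zero]

lemma starProjection_basisSpan_apply (n : ℕ) (f : ell2) (k : ℕ) :
    (basisSpan n).starProjection f k = if k < n then f k else 0 := by
  rw [starProjection_basisSpan, sum_single_apply]
  simp

lemma tendsto_starProjection_basisSpan (f : ell2) :
    Tendsto (fun n => (basisSpan n).starProjection f) atTop (𝓝 f) := by
  simp only [starProjection_basisSpan]
  exact (lp.hasSum_single (by norm_num) f).tendsto_sum_nat

lemma isCompactOperator_starProjection (n : ℕ) :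
    IsCompactOperator (basisSpan n).starProjection := by
  have : ProperSpace (basisSpan n) := FiniteDimensional.proper ℂ _
  exact (isCompactOperator_of_locallyCompactSpace_rng (basisSpan n).subtypeL).comp_clm
    (basisSpan n).orthogonalProjectionOnto

/-- It is the norm limit of its finite-rank truncations, the error being the supremum of the tail of
`a`. -/
lemma isCompactOperator_diagCLM {a : ℕ → ℂ} {C : ℝ} (ha : ∀ n, ‖a n‖ ≤ C)
    (hlim : Tendsto a atTop (𝓝 0)) : IsCompactOperator (diagCLM a C ha) := by
  refine isCompactOperator_of_tendsto (l := atTop)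
    (F := fun n => (basisSpan n).starProjection ∘L diagCLM a C ha) ?_
    (Eventually.of_forall fun n => (isCompactOperator_starProjection n).comp_clm _)
  rw [tendsto_iff_norm_sub_tendsto_zero, Metric.tendsto_atTop]
  intro ε hε
  obtain ⟨N, hN⟩ := Metric.tendsto_atTop.1 hlim (ε / 2) (by positivity)
  refine ⟨N, fun n hn => ?_⟩
  rw [Real.dist_0_eq_abs, abs_norm]
  refine lt_of_le_of_lt (b := ε / 2) ?_ (by linarith)
  refine ContinuousLinearMap.opNorm_le_bound _ (by positivity) fun f => ?_
  refine norm_le_of_forall_norm_le (by positivity) fun k => ?_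
  have : (((basisSpan n).starProjection ∘L diagCLM a C ha) - diagCLM a C ha) f k =
      (if k < n then a k * f k else 0) - a k * f k := by
    have := starProjection_basisSpan_apply n (diagCLM a C ha f) k
    rw [diagCLM_apply] at this
    rw [← this]
    rfl
  rw [this]
  split_ifs with hk
  · simp; positivity
  · rw [zero_sub, norm_neg, norm_mul]
    refine mul_le_mul_of_nonneg_right ?_ (norm_nonneg _)
    simpa using (hN k (by omega)).le

lemma adjoint_diagCLM {a : ℕ → ℂ} {C : ℝ} (ha : ∀ n, ‖a n‖ ≤ C) :
    ContinuousLinearMap.adjoint (diagCLM a C ha) =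
      diagCLM (fun n => starRingEnd ℂ (a n)) C (fun n => by simpa using ha n) := by
  symm
  rw [ContinuousLinearMap.eq_adjoint_iff]
  intro f g
  rw [lp.inner_eq_tsum, lp.inner_eq_tsum]
  refine tsum_congr fun n => ?_
  simp
  ring

/-- A diagonal operator with entries tending to zero, followed by the tails of the canonical
basis on the right, tends to zero in norm. -/
lemma tendsto_norm_diagCLM_comp_tail {a : ℕ → ℂ} {C : ℝ} (ha : ∀ n, ‖a n‖ ≤ C)
    (hlim : Tendsto a atTop (𝓝 0)) (U : ell2 →L[ℂ] ell2) :
    Tendsto (fun n => ‖(diagCLM a C ha ∘L U) ∘L (1 - (basisSpan n).starProjection)‖) atTop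
      (𝓝 0) := by
  -- Strong convergence helps only on the left of a compact operator. Taking adjoints moves the
  -- self-adjoint tail projection there and preserves norms.
  have hcomp : IsCompactOperator (ContinuousLinearMap.adjoint (diagCLM a C ha ∘L U)) := by
    rw [ContinuousLinearMap.adjoint_comp, adjoint_diagCLM]
    refine (isCompactOperator_diagCLM _ ?_).clm_comp (ContinuousLinearMap.adjoint U)
    simpa [Function.comp_def] using (Complex.continuous_conj.tendsto 0).comp hlim
  have hQ : ∀ n, (1 - (basisSpan n).starProjection : ell2 →L[ℂ] ell2) =
      (basisSpan n)ᗮ.starProjection := fun n => by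
    rw [Submodule.starProjection_orthogonal]; rfl
  have := tendsto_norm_comp_of_isCompactOperator
    (Q := fun n => 1 - (basisSpan n).starProjection)
    (fun n => by rw [hQ]; exact Submodule.starProjection_norm_le _)
    (fun x => by simpa using (tendsto_starProjection_basisSpan x).const_sub x) hcomp
  refine this.congr fun n => ?_
  rw [← LinearIsometryEquiv.norm_map ContinuousLinearMap.adjoint
    ((diagCLM a C ha ∘L U) ∘L (1 - (basisSpan n).starProjection)),
    ContinuousLinearMap.adjoint_comp (diagCLM a C ha ∘L U), hQ]
  congr 2
  exact (isSelfAdjoint_starProjection _).adjoint_eq.symm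

end BoundedOperators

/-! ### Diagonally dominant tridiagonal operators -/

namespace TridiagMatrix

/-- The off-diagonal entries are dominated by those of `diag - z`, with constant less than `1/2`
in each of the two directions, and `diag - z` grows quadratically. -/
structure DominatedAt (M : TridiagMatrix) (z : ℂ) (q κ : ℝ) : Prop where
  lt_half : q < 1 / 2
  pos : 0 < κ
  sub_le : ∀ n, |M.sub (n + 1)| ≤ q * ‖(M.diag n : ℂ) - z‖
  sup_le : ∀ n, |M.sup n| ≤ q * ‖(M.diag (n + 1) : ℂ) - z‖
  diag_ge : ∀ n : ℕ, κ * ((n : ℝ) + 1) ^ 2 ≤ ‖(M.diag n : ℂ) - z‖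

variable (M : TridiagMatrix)

lemma mem_op_domain {c : ell2} (hc : c ∈ ell24) : c ∈ M.op.domain := hc

lemma op_apply (c : ell2) (hc : c ∈ M.op.domain) (n : ℕ) :
    M.op ⟨c, hc⟩ n = M.subSeq c n + M.diagSeq c n + M.supSeq c n := rfl

lemma diagPart_op_apply (c : ell2) (hc : c ∈ M.diagPart.op.domain) (n : ℕ) :
    M.diagPart.op ⟨c, hc⟩ n = M.diag n * c n := by
  rw [op_apply]
  cases n <;> simp [subSeq, diagSeq, supSeq, diagPart]

lemma offDiagPart_op_apply_zero (c : ell2) (hc : c ∈ M.offDiagPart.op.domain) :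
    M.offDiagPart.op ⟨c, hc⟩ 0 = M.sup 0 * c 1 := by
  rw [op_apply]
  simp [subSeq, diagSeq, supSeq, offDiagPart]

lemma offDiagPart_op_apply_succ (c : ell2) (hc : c ∈ M.offDiagPart.op.domain) (n : ℕ) :
    M.offDiagPart.op ⟨c, hc⟩ (n + 1) = M.sub (n + 1) * c n + M.sup (n + 1) * c (n + 2) := by
  rw [op_apply]
  simp [subSeq, diagSeq, supSeq, offDiagPart]

lemma op_eq_add (c : ell2) (hc : c ∈ M.op.domain) (hc₁ : c ∈ M.diagPart.op.domain)
    (hc₂ : c ∈ M.offDiagPart.op.domain) :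
    M.op ⟨c, hc⟩ = M.diagPart.op ⟨c, hc₁⟩ + M.offDiagPart.op ⟨c, hc₂⟩ := by
  ext n
  rw [op_apply, lp.coeFn_add, Pi.add_apply, diagPart_op_apply]
  cases n with
  | zero => rw [offDiagPart_op_apply_zero]; simp [subSeq, diagSeq, supSeq]
  | succ n => rw [offDiagPart_op_apply_succ]; simp only [subSeq, diagSeq, supSeq]; ring

lemma truncOp_domain (n : ℕ) : (M.truncOp n).domain = ell24 := inf_idem _

lemma truncOp_apply (n : ℕ) (c : ell2) (hc : c ∈ (M.truncOp n).domain)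
    (hc₁ : c ∈ M.diagPart.op.domain) (hc₂ : c ∈ M.offDiagPart.op.domain) :
    M.truncOp n ⟨c, hc⟩ = M.diagPart.op ⟨c, hc₁⟩ +
      (basisSpan n).starProjection (M.offDiagPart.op ⟨c, hc₂⟩) := rfl

variable {M} {z : ℂ} {q κ : ℝ} (h : M.DominatedAt z q κ)

include h

lemma DominatedAt.diag_sub_ne_zero (n : ℕ) : (M.diag n : ℂ) - z ≠ 0 := by
  have h1 := h.diag_ge n
  have h2 := h.pos
  rw [← norm_pos_iff]
  exact lt_of_lt_of_le (by positivity) h1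

lemma DominatedAt.norm_inv_le' (n : ℕ) :
    ‖((M.diag n : ℂ) - z)⁻¹‖ ≤ κ⁻¹ * (((n : ℝ) + 1) ^ 2)⁻¹ := by
  have := h.pos
  rw [norm_inv, ← mul_inv]
  exact inv_anti₀ (by positivity) (h.diag_ge n)

lemma DominatedAt.norm_inv_le (n : ℕ) : ‖((M.diag n : ℂ) - z)⁻¹‖ ≤ κ⁻¹ := by
  have := h.pos
  refine (h.norm_inv_le' n).trans (mul_le_of_le_one_right (by positivity) ?_)
  refine inv_le_one_of_one_le₀ (one_le_pow₀ ?_)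
  linarith [(Nat.cast_nonneg n : (0 : ℝ) ≤ n)]

lemma DominatedAt.tendsto_inv : Tendsto (fun n => ((M.diag n : ℂ) - z)⁻¹) atTop (𝓝 0) := by
  refine squeeze_zero_norm h.norm_inv_le' ?_
  have h1 : Tendsto (fun n : ℕ => ((n : ℝ) + 1) ^ 2) atTop atTop :=
    (tendsto_pow_atTop two_ne_zero).comp
      (tendsto_atTop_add_const_right _ _ tendsto_natCast_atTop_atTop)
  simpa using h1.inv_tendsto_atTop.const_mul κ⁻¹

/-- The resolvent of the diagonal part. -/
def DominatedAt.diagRes : ell2 →L[ℂ] ell2 :=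
  diagCLM (fun n => ((M.diag n : ℂ) - z)⁻¹) κ⁻¹ h.norm_inv_le

lemma DominatedAt.diagRes_apply (f : ell2) (n : ℕ) :
    h.diagRes f n = ((M.diag n : ℂ) - z)⁻¹ * f n := rfl

/-- The quadratic growth of `diag - z` exactly pays for the weight `n⁴` in the domain. -/
lemma DominatedAt.diagRes_mem (f : ell2) : h.diagRes f ∈ ell24 := by
  have hκ := h.pos
  refine Summable.of_nonneg_of_le (fun n => by positivity) (fun n => ?_)
    ((summable_norm_sq f).mul_left (κ⁻¹ ^ 2))
  rw [h.diagRes_apply, norm_mul]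
  have h1 : (n : ℝ) ^ 2 * ‖((M.diag n : ℂ) - z)⁻¹‖ ≤ κ⁻¹ := by
    refine (mul_le_mul_of_nonneg_left (h.norm_inv_le' n) (by positivity)).trans ?_
    rw [mul_left_comm, ← div_eq_mul_inv]
    refine mul_le_of_le_one_right (by positivity) (div_le_one_of_le₀ ?_ (by positivity))
    have : (0 : ℝ) ≤ n := Nat.cast_nonneg n
    nlinarith
  calc (n : ℝ) ^ 4 * (‖((M.diag n : ℂ) - z)⁻¹‖ * ‖f n‖) ^ 2
      = ((n : ℝ) ^ 2 * ‖((M.diag n : ℂ) - z)⁻¹‖) ^ 2 * ‖f n‖ ^ 2 := by ring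
    _ ≤ κ⁻¹ ^ 2 * ‖f n‖ ^ 2 := by gcongr

lemma DominatedAt.exists_diagRes_eq {c : ell2} (hc : c ∈ ell24) : ∃ f, h.diagRes f = c := by
  refine ⟨M.diagPart.op ⟨c, M.diagPart.mem_op_domain hc⟩ - z • c, ?_⟩
  ext n
  rw [h.diagRes_apply, lp.coeFn_sub, Pi.sub_apply, diagPart_op_apply, lp.coeFn_smul,
    Pi.smul_apply, smul_eq_mul, ← sub_mul, inv_mul_cancel_left₀ (h.diag_sub_ne_zero n)]

lemma DominatedAt.norm_sub_mul_inv_le (n : ℕ) :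
    ‖(M.sub (n + 1) : ℂ) * ((M.diag n : ℂ) - z)⁻¹‖ ≤ q := by
  rw [← div_eq_mul_inv, norm_div, Complex.norm_real, Real.norm_eq_abs,
    div_le_iff₀ (norm_pos_iff.2 (h.diag_sub_ne_zero n))]
  exact h.sub_le n

lemma DominatedAt.norm_sup_mul_inv_le (n : ℕ) :
    ‖(M.sup n : ℂ) * ((M.diag (n + 1) : ℂ) - z)⁻¹‖ ≤ q := by
  rw [← div_eq_mul_inv, norm_div, Complex.norm_real, Real.norm_eq_abs,
    div_le_iff₀ (norm_pos_iff.2 (h.diag_sub_ne_zero (n + 1)))]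
  exact h.sup_le n

/-- The off-diagonal part composed with the resolvent of the diagonal part. -/
def DominatedAt.offDiagRes : ell2 →L[ℂ] ell2 :=
  shiftRight ∘L diagCLM _ q h.norm_sub_mul_inv_le + diagCLM _ q h.norm_sup_mul_inv_le ∘L shiftLeft

/-- Each of the two shifted diagonals contributes at most `q`; this is why the dominance constant
has to be below `1/2`. -/
lemma DominatedAt.norm_offDiagRes_le : ‖h.offDiagRes‖ ≤ 2 * q := by
  have hq : 0 ≤ q := (norm_nonneg _).trans (h.norm_sub_mul_inv_le 0)
  refine (norm_add_le _ _).trans ?_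
  rw [two_mul]
  refine add_le_add ?_ ?_
  · refine (ContinuousLinearMap.opNorm_comp_le _ _).trans ?_
    simpa using mul_le_mul norm_shiftRight_le (norm_diagCLM_le _ q h.norm_sub_mul_inv_le)
      (norm_nonneg _) zero_le_one
  · refine (ContinuousLinearMap.opNorm_comp_le _ _).trans ?_
    simpa using mul_le_mul (norm_diagCLM_le _ q h.norm_sup_mul_inv_le) norm_shiftLeft_le
      (norm_nonneg _) hq

lemma DominatedAt.offDiagPart_op_diagRes (f : ell2) (hf : h.diagRes f ∈ M.offDiagPart.op.domain) :
    M.offDiagPart.op ⟨h.diagRes f, hf⟩ = h.offDiagRes f := by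
  ext n
  cases n with
  | zero =>
    rw [offDiagPart_op_apply_zero]
    simp [offDiagRes, diagRes_apply]
    ring
  | succ n =>
    rw [offDiagPart_op_apply_succ]
    simp [offDiagRes, diagRes_apply]
    ring

lemma DominatedAt.diagPart_op_diagRes (f : ell2) (hf : h.diagRes f ∈ M.diagPart.op.domain) :
    M.diagPart.op ⟨h.diagRes f, hf⟩ - z • h.diagRes f = f := by
  ext n
  rw [lp.coeFn_sub, Pi.sub_apply, diagPart_op_apply, lp.coeFn_smul, Pi.smul_apply, smul_eq_mul,
    ← sub_mul, h.diagRes_apply, mul_inv_cancel_left₀ (h.diag_sub_ne_zero n)]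

lemma DominatedAt.isResolventAt_op {U : ell2 →L[ℂ] ell2} (h1 : (1 + h.offDiagRes) * U = 1)
    (h2 : U * (1 + h.offDiagRes) = 1) : IsResolventAt M.op z (h.diagRes ∘L U) := by
  refine isResolventAt_comp (B := 1 + h.offDiagRes) (fun f => ⟨M.mem_op_domain (h.diagRes_mem f), ?_⟩)
    (fun x hx => h.exists_diagRes_eq hx) (fun f => DFunLike.congr_fun h1 f)
    (fun f => DFunLike.congr_fun h2 f)
  rw [M.op_eq_add _ _ (M.diagPart.mem_op_domain (h.diagRes_mem f))
    (M.offDiagPart.mem_op_domain (h.diagRes_mem f)), add_sub_right_comm, h.diagPart_op_diagRes, h.offDiagPart_op_diagRes]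
  rfl

lemma DominatedAt.isResolventAt_truncOp (n : ℕ) {U : ell2 →L[ℂ] ell2}
    (h1 : (1 + (basisSpan n).starProjection * h.offDiagRes) * U = 1)
    (h2 : U * (1 + (basisSpan n).starProjection * h.offDiagRes) = 1) :
    IsResolventAt (M.truncOp n) z (h.diagRes ∘L U) := by
  refine isResolventAt_comp (B := 1 + (basisSpan n).starProjection * h.offDiagRes)
    (fun f => ⟨(M.truncOp_domain n).ge (h.diagRes_mem f), ?_⟩)
    (fun x hx => h.exists_diagRes_eq ((M.truncOp_domain n).le hx))
    (fun f => DFunLike.congr_fun h1 f)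
    (fun f => DFunLike.congr_fun h2 f)
  rw [M.truncOp_apply n _ _ (M.diagPart.mem_op_domain (h.diagRes_mem f))
    (M.offDiagPart.mem_op_domain (h.diagRes_mem f)), add_sub_right_comm,
    h.diagPart_op_diagRes, h.offDiagPart_op_diagRes]
  rfl

theorem DominatedAt.closed_compactResolvent_convergesGeneralized :
    (M.op.IsClosed ∧ HasCompactResolvent M.op) ∧ ConvergesGeneralized M.truncOp M.op := by
  have hq : 2 * q < 1 := by linarith [h.lt_half]
  have hPK : ∀ n, ‖(basisSpan n).starProjection * h.offDiagRes‖ ≤ 2 * q := fun n => by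
    refine (norm_mul_le _ _).trans ?_
    have := Submodule.starProjection_norm_le (basisSpan n)
    nlinarith [h.norm_offDiagRes_le, norm_nonneg h.offDiagRes]
  obtain ⟨U, hU1, hU2, -⟩ := exists_inverse_one_add h.offDiagRes h.norm_offDiagRes_le hq
  choose V hV1 hV2 hV3 using fun n => exists_inverse_one_add _ (hPK n) hq
  have hS := h.isResolventAt_op hU1 hU2
  have hSn := fun n => h.isResolventAt_truncOp n (hV1 n) (hV2 n)
  refine ⟨⟨hS.isClosed, hS.hasCompactResolvent
    ((isCompactOperator_diagCLM h.norm_inv_le h.tendsto_inv).comp_clm U)⟩,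
    convergesGeneralized_of_resolvent hS hSn ?_⟩
  have hlim : Tendsto (fun n => ‖(h.diagRes ∘L U) ∘L (1 - (basisSpan n).starProjection)‖) atTop
      (𝓝 0) := tendsto_norm_diagCLM_comp_tail h.norm_inv_le h.tendsto_inv U
  refine squeeze_zero (fun n => norm_nonneg _) (fun n => ?_)
    (zero_mul (2 * q * (1 - 2 * q)⁻¹) ▸ hlim.mul_const _)
  -- The identity `V - U = U (B - B_n) V` for inverses `U`, `V` of `B = 1 + K` and `B_n = 1 + P_n
  -- K`, where `B - B_n = (1 - P_n) K`.
  have key : V n - U =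
      U * (1 - (basisSpan n).starProjection) * (h.offDiagRes * V n) := by
    have : U * ((1 + h.offDiagRes) - (1 + (basisSpan n).starProjection * h.offDiagRes)) * V n =
        V n - U := by
      rw [mul_sub, sub_mul, hU2, mul_assoc U, hV1, one_mul, mul_one]
    rw [← this]
    noncomm_ring
  have hdiff : h.diagRes ∘L V n - h.diagRes ∘L U =
      ((h.diagRes ∘L U) ∘L (1 - (basisSpan n).starProjection)) ∘L (h.offDiagRes * V n) := by
    rw [← ContinuousLinearMap.comp_sub, key]
    rfl
  rw [hdiff]
  refine (ContinuousLinearMap.opNorm_comp_le _ _).trans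
    (mul_le_mul_of_nonneg_left ?_ (norm_nonneg _))
  exact (norm_mul_le _ _).trans (mul_le_mul h.norm_offDiagRes_le (hV3 n) (norm_nonneg _)
    ((norm_nonneg _).trans h.norm_offDiagRes_le))

end TridiagMatrix

/-! ### Dominance after a large negative shift -/

namespace TridiagMatrix

/-- Only the leading coefficients matter: with `q` strictly between `α / δ` and `1 / 2`, the surplus
`(q δ - α) n²` and a large shift `t` absorb all linear terms. -/
lemma exists_dominatedAt (M : TridiagMatrix) {α δ L : ℝ} (hα : 0 ≤ α) (hαδ : 2 * α < δ)
    (hL : 0 ≤ L) (hsub : ∀ n : ℕ, |M.sub (n + 1)| ≤ α * (n : ℝ) ^ 2 + L * (n + 1))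
    (hsup : ∀ n : ℕ, |M.sup n| ≤ α * (n : ℝ) ^ 2 + L * (n + 1))
    (hdiag : ∀ n : ℕ, δ * (n : ℝ) ^ 2 - L * (n + 1) ≤ M.diag n) :
    ∃ z q κ, M.DominatedAt z q κ := by
  have hδ : 0 < δ := by linarith
  obtain ⟨q, hq1, hq2⟩ : ∃ q, α / δ < q ∧ q < 1 / 2 :=
    exists_between (by rw [div_lt_iff₀ hδ]; linarith)
  have hq0 : 0 < q := lt_of_le_of_lt (by positivity) hq1
  rw [div_lt_iff₀ hδ] at hq1
  set ε := q * δ - α with hε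
  have hε0 : 0 < ε := by linarith
  set L' := L + q * L with hL'
  have hL'0 : 0 ≤ L' := by positivity
  -- The first bound serves the off-diagonals; the summand `2 * L'` rather than `L'` covers the
  -- comparison of `sup n` with `diag (n + 1)`. The second bound serves the growth constant `δ / 4`,
  -- through `(n + 1)² ≤ 2 (n² + 1)`.
  obtain ⟨t, ht1, ht2⟩ : ∃ t, (L' ^ 2 / (4 * ε) + 2 * L') / q ≤ t ∧
      L ^ 2 / (2 * δ) + L + δ / 2 ≤ t := ⟨_, le_max_left _ _, le_max_right _ _⟩
  rw [div_le_iff₀ hq0] at ht1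
  have amgm : ∀ x : ℝ, L' * x ≤ ε * x ^ 2 + L' ^ 2 / (4 * ε) := fun x => by
    have : ε * x ^ 2 + L' ^ 2 / (4 * ε) - L' * x = (2 * ε * x - L') ^ 2 / (4 * ε) := by
      field_simp; ring
    have : 0 ≤ (2 * ε * x - L') ^ 2 / (4 * ε) := by positivity
    linarith
  have amgm' : ∀ x : ℝ, L * x ≤ δ / 2 * x ^ 2 + L ^ 2 / (2 * δ) := fun x => by
    have : δ / 2 * x ^ 2 + L ^ 2 / (2 * δ) - L * x = (δ * x - L) ^ 2 / (2 * δ) := by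
      field_simp; ring
    have : 0 ≤ (δ * x - L) ^ 2 / (2 * δ) := by positivity
    linarith
  have hnorm : ∀ n : ℕ, δ * (n : ℝ) ^ 2 - L * (n + 1) + t ≤ ‖(M.diag n : ℂ) - ((-t : ℝ) : ℂ)‖ :=
    fun n => by
      rw [← Complex.ofReal_sub, Complex.norm_real, Real.norm_eq_abs]
      exact le_trans (by linarith [hdiag n]) (le_abs_self _)
  refine ⟨((-t : ℝ) : ℂ), q, δ / 4, hq2, by positivity, fun n => ?_, fun n => ?_, fun n => ?_⟩
  · refine (hsub n).trans (le_trans ?_ (mul_le_mul_of_nonneg_left (hnorm n) hq0.le))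
    have := amgm n
    rw [hε, hL'] at this
    nlinarith
  · refine (hsup n).trans (le_trans ?_ (mul_le_mul_of_nonneg_left (hnorm (n + 1)) hq0.le))
    have := amgm n
    rw [hε] at this
    have h1 : 0 ≤ q * δ * (2 * n + 1) := by positivity
    have h2 : 0 ≤ q * L := by positivity
    push_cast
    nlinarith
  · refine le_trans ?_ (hnorm n)
    have := amgm' n
    nlinarith [sq_nonneg ((n : ℝ) - 1)]

/-! ### Symmetric factorization and location of the eigenvalues -/

/-- The matrix is the product of the symmetric tridiagonal matrix with diagonal `a` and
off-diagonal `b`, and the diagonal matrix with entries `w`; all the factors grow at most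
linearly. -/
structure IsFactored (M : TridiagMatrix) (w a b : ℕ → ℝ) (C : ℝ) : Prop where
  sub_eq : ∀ n, M.sub (n + 1) = b n * w n
  diag_eq : ∀ n, M.diag n = a n * w n
  sup_eq : ∀ n, M.sup n = b n * w (n + 1)
  w_le : ∀ n : ℕ, |w n| ≤ C * ((n : ℝ) + 1)
  a_le : ∀ n : ℕ, |a n| ≤ C * ((n : ℝ) + 1)
  b_le : ∀ n : ℕ, |b n| ≤ C * ((n : ℝ) + 1)

variable {M : TridiagMatrix} {w a b : ℕ → ℝ} {C : ℝ}

/-- The quadratic form of the symmetric factor, evaluated at `w c`, term by term. -/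
def quadTerm (w a b : ℕ → ℝ) (c : ℕ → ℂ) (n : ℕ) : ℝ :=
  a n * ‖(w n : ℂ) * c n‖ ^ 2 +
    2 * (b n * (starRingEnd ℂ ((w n : ℂ) * c n) * ((w (n + 1) : ℂ) * c (n + 1))).re)

section Summability

variable {c : ell2} (hc : c ∈ ell24) (h : M.IsFactored w a b C)

include hc in
lemma summable_of_le_weight {E : Type*} [NormedAddCommGroup E] [CompleteSpace E] {s : ℕ → E}
    {D : ℝ} (hs : ∀ n : ℕ, ‖s n‖ ≤
      D * (((n : ℝ) + 1) ^ 4 * ‖c n‖ ^ 2 + ((n : ℝ) + 2) ^ 4 * ‖c (n + 1)‖ ^ 2)) :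
    Summable s := by
  have hg := summable_succ_pow_four (lp.memℓp c) hc
  have hg' : Summable fun n : ℕ => ((n : ℝ) + 2) ^ 4 * ‖c (n + 1)‖ ^ 2 := by
    refine ((summable_nat_add_iff 1).2 hg).congr fun n => ?_
    push_cast
    ring
  exact Summable.of_norm_bounded ((hg.add hg').mul_left D) hs

include h

lemma IsFactored.const_nonneg : 0 ≤ C := by
  simpa using (abs_nonneg _).trans (h.w_le 0)

lemma IsFactored.norm_weight_mul_le (n : ℕ) :
    ‖(w n : ℂ) * c n‖ ≤ C * ((n : ℝ) + 1) * ‖c n‖ := by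
  rw [norm_mul, Complex.norm_real, Real.norm_eq_abs]
  exact mul_le_mul_of_nonneg_right (h.w_le n) (norm_nonneg _)

include hc

lemma IsFactored.summable_weight : Summable fun n => w n * ‖c n‖ ^ 2 := by
  have hC := h.const_nonneg
  refine summable_of_le_weight hc (D := C) fun n => ?_
  rw [norm_mul, Real.norm_eq_abs, Real.norm_eq_abs, abs_sq]
  have h1 : (n : ℝ) + 1 ≤ ((n : ℝ) + 1) ^ 4 := le_self_pow₀ (by simp) (by norm_num)
  calc |w n| * ‖c n‖ ^ 2 ≤ C * ((n : ℝ) + 1) ^ 4 * ‖c n‖ ^ 2 := by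
        gcongr
        exact (h.w_le n).trans (by gcongr)
    _ ≤ _ := by
        rw [mul_add, ← mul_assoc]
        exact le_add_of_nonneg_right (by positivity)

/-- Three factors of linear growth cost `(n + 1)³`, within the available weight `(n + 1)⁴`. -/
lemma IsFactored.summable_mul_norm_sq {d : ℕ → ℝ} (hd : ∀ n : ℕ, |d n| ≤ C * ((n : ℝ) + 1)) :
    Summable fun n => d n * ‖(w n : ℂ) * c n‖ ^ 2 := by
  have hC := h.const_nonneg
  refine summable_of_le_weight hc (D := C ^ 3) fun n => ?_
  rw [norm_mul, Real.norm_eq_abs, Real.norm_eq_abs, abs_sq]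
  have h1 : ((n : ℝ) + 1) ^ 3 ≤ ((n : ℝ) + 1) ^ 4 := pow_le_pow_right₀ (by simp) (by norm_num)
  calc |d n| * ‖(w n : ℂ) * c n‖ ^ 2
      ≤ C * ((n : ℝ) + 1) * (C * ((n : ℝ) + 1) * ‖c n‖) ^ 2 := by
        gcongr
        · exact hd n
        · exact h.norm_weight_mul_le n
    _ = C ^ 3 * ((n : ℝ) + 1) ^ 3 * ‖c n‖ ^ 2 := by ring
    _ ≤ C ^ 3 * ((n : ℝ) + 1) ^ 4 * ‖c n‖ ^ 2 := by gcongr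
    _ ≤ _ := by
        rw [mul_add, ← mul_assoc]
        exact le_add_of_nonneg_right (by positivity)

lemma IsFactored.summable_mul_norm_sq_succ :
    Summable fun n => b n * ‖(w (n + 1) : ℂ) * c (n + 1)‖ ^ 2 := by
  -- At `n = 0` the truncated subtraction gives `b 0`, a value that the shift of the index discards.
  have hd : ∀ n : ℕ, |(fun n => b (n - 1)) n| ≤ C * ((n : ℝ) + 1) := fun n => by
    refine (h.b_le (n - 1)).trans (mul_le_mul_of_nonneg_left ?_ h.const_nonneg)
    gcongr
    exact n.sub_le 1
  exact (summable_nat_add_iff 1).2 (h.summable_mul_norm_sq hc hd)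

lemma IsFactored.summable_cross : Summable fun n =>
    (b n : ℂ) * (starRingEnd ℂ ((w n : ℂ) * c n) * ((w (n + 1) : ℂ) * c (n + 1))) := by
  have hb : ∀ n : ℕ, |(fun n => |b n|) n| ≤ C * ((n : ℝ) + 1) := fun n => by
    simpa using h.b_le n
  have hG := h.summable_mul_norm_sq hc hb
  have hb' : ∀ n : ℕ, |(fun n => |b (n - 1)|) n| ≤ C * ((n : ℝ) + 1) := fun n => by
    simp only [abs_abs]
    refine (h.b_le (n - 1)).trans (mul_le_mul_of_nonneg_left ?_ h.const_nonneg)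
    gcongr
    exact n.sub_le 1
  have hH := (summable_nat_add_iff 1).2 (h.summable_mul_norm_sq hc hb')
  refine Summable.of_norm_bounded (hG.add hH) fun n => ?_
  simp only [Nat.add_sub_cancel]
  rw [norm_mul, norm_mul, RCLike.norm_conj, Complex.norm_real, Real.norm_eq_abs, ← mul_add]
  refine mul_le_mul_of_nonneg_left ?_ (abs_nonneg _)
  nlinarith [sq_nonneg (‖(w n : ℂ) * c n‖ - ‖(w (n + 1) : ℂ) * c (n + 1)‖),
    sq_nonneg (‖(w n : ℂ) * c n‖), sq_nonneg (‖(w (n + 1) : ℂ) * c (n + 1)‖)]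

lemma IsFactored.summable_quadTerm : Summable (quadTerm w a b c) := by
  refine (h.summable_mul_norm_sq hc h.a_le).add (Summable.mul_left 2 ?_)
  refine (Complex.reCLM.summable (h.summable_cross hc)).congr fun n => ?_
  simp only [Complex.reCLM_apply, Complex.re_ofReal_mul]

/-- Pairing `T c = z c` with `w c`. -/
lemma IsFactored.mul_tsum_weight_eq (hc' : c ∈ M.op.domain) {z : ℂ}
    (hz : M.op ⟨c, hc'⟩ = z • c) :
    z * ((∑' n, w n * ‖c n‖ ^ 2 : ℝ) : ℂ) = ((∑' n, quadTerm w a b c n : ℝ) : ℂ) := by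
  set e : ℕ → ℂ := fun n =>
    (b n : ℂ) * (starRingEnd ℂ ((w n : ℂ) * c n) * ((w (n + 1) : ℂ) * c (n + 1))) with he
  have hesum : Summable e := h.summable_cross hc
  obtain ⟨E, hE⟩ := hesum
  obtain ⟨F, hF'⟩ := h.summable_mul_norm_sq hc h.a_le
  have hF := Complex.hasSum_ofReal.2 hF'
  have hN := (Complex.hasSum_ofReal.2 (h.summable_weight hc).hasSum).mul_left z
  have hQ := Complex.hasSum_ofReal.2 (h.summable_quadTerm hc).hasSum
  have hEc : HasSum (fun n => starRingEnd ℂ (e n)) (starRingEnd ℂ E) :=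
    Complex.hasSum_conj'.2 (by simpa using hE)
  -- By symmetry the subdiagonal term of row `n + 1` is the conjugate of the superdiagonal term of
  -- row `n`. Summing by rows therefore only shifts the conjugate series, with a zero in front.
  have hEs : HasSum (shiftRightSeq fun n => starRingEnd ℂ (e n)) (starRingEnd ℂ E) := by
    refine (hasSum_nat_add_iff' 1).1 ?_
    simpa [shiftRightSeq] using hEc
  have h1 : HasSum (fun n => z * ((w n * ‖c n‖ ^ 2 : ℝ) : ℂ)) (starRingEnd ℂ E + F + E) := by
    refine HasSum.congr_fun ((hEs.add hF).add hE) fun n => ?_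
    have hn : M.subSeq c n + M.diagSeq c n + M.supSeq c n = z * c n := by
      rw [← M.op_apply c hc' n, hz]; rfl
    have hsq : ((‖c n‖ ^ 2 : ℝ) : ℂ) = starRingEnd ℂ (c n) * c n := by
      rw [← Complex.normSq_eq_conj_mul_self, Complex.normSq_eq_norm_sq]
    have hsq' : ((‖(w n : ℂ) * c n‖ ^ 2 : ℝ) : ℂ) =
        starRingEnd ℂ ((w n : ℂ) * c n) * ((w n : ℂ) * c n) := by
      rw [← Complex.normSq_eq_conj_mul_self, Complex.normSq_eq_norm_sq]
    have hlhs : z * ((w n * ‖c n‖ ^ 2 : ℝ) : ℂ) =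
        starRingEnd ℂ ((w n : ℂ) * c n) *
          (M.subSeq c n + M.diagSeq c n + M.supSeq c n) := by
      rw [hn, Complex.ofReal_mul, hsq, map_mul, Complex.conj_ofReal]; ring
    rw [hlhs, Complex.ofReal_mul, hsq', he]
    cases n with
    | zero =>
      simp only [subSeq, diagSeq, supSeq, shiftRightSeq, h.diag_eq, h.sup_eq]
      push_cast
      ring
    | succ n =>
      simp only [subSeq, diagSeq, supSeq, shiftRightSeq, h.diag_eq, h.sup_eq, h.sub_eq, map_mul,
        Complex.conj_ofReal, Complex.conj_conj]
      push_cast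
      ring
  have h2 : HasSum (fun n => ((quadTerm w a b c n : ℝ) : ℂ))
      (starRingEnd ℂ E + F + E) := by
    refine HasSum.congr_fun ((hEc.add hF).add hE) fun n => ?_
    have : ((2 * (b n * (starRingEnd ℂ ((w n : ℂ) * c n) *
        ((w (n + 1) : ℂ) * c (n + 1))).re) : ℝ) : ℂ) = e n + starRingEnd ℂ (e n) := by
      rw [Complex.add_conj, he, Complex.re_ofReal_mul]
    rw [quadTerm, Complex.ofReal_add, this]
    ring
  rw [hN.unique h1, hQ.unique h2]

/-- Diagonal dominance of the symmetric factor makes its quadratic form definite. -/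
lemma IsFactored.quadTerm_definite (hb : ∀ n, 0 ≤ b n) (h0 : w 0 ≠ 0 → b 0 < a 0)
    (hS : ∀ n, b n + b (n + 1) < a (n + 1)) :
    0 ≤ ∑' n, quadTerm w a b c n ∧
      (∑' n, quadTerm w a b c n = 0 → ∀ n, (w n : ℂ) * c n = 0) := by
  have hG := h.summable_mul_norm_sq hc h.b_le
  have hH := h.summable_mul_norm_sq_succ hc
  set u : ℕ → ℂ := fun n => (w n : ℂ) * c n with hu
  -- What remains after `2 b_n Re(ū_n u_{n+1}) ≥ -b_n (|u_n|² + |u_{n+1}|²)` and regrouping by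
  -- index: the coefficient is `a_n - b_n - b_{n-1}`, with `b_{-1} = 0`.
  set g : ℕ → ℝ := fun n => (a n - b n - Nat.casesOn n 0 fun k => b k) * ‖u n‖ ^ 2 with hg
  have hHs : HasSum (fun n => (Nat.casesOn n 0 fun k => b k : ℝ) * ‖u n‖ ^ 2)
      (∑' n, b n * ‖u (n + 1)‖ ^ 2) := by
    refine (hasSum_nat_add_iff' 1).1 ?_
    rw [Finset.sum_range_one]
    change HasSum _ (_ - 0 * ‖u 0‖ ^ 2)
    rw [zero_mul, sub_zero]
    exact hH.hasSum
  have hgsum : HasSum g (∑' n, (a n * ‖u n‖ ^ 2 - b n * ‖u n‖ ^ 2 - b n * ‖u (n + 1)‖ ^ 2)) := by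
    have hA := (h.summable_mul_norm_sq hc h.a_le)
    rw [(hA.sub hG).tsum_sub hH]
    refine HasSum.congr_fun ((hA.sub hG).hasSum.sub hHs) fun n => ?_
    simp only [hg]
    ring
  have hle : ∑' n, g n ≤ ∑' n, quadTerm w a b c n := by
    rw [hgsum.tsum_eq]
    refine Summable.tsum_le_tsum (fun n => ?_)
      (((h.summable_mul_norm_sq hc h.a_le).sub hG).sub hH) (h.summable_quadTerm hc)
    have h1 : -(‖u n‖ * ‖u (n + 1)‖) ≤ (starRingEnd ℂ (u n) * u (n + 1)).re := by
      have := Complex.abs_re_le_norm (starRingEnd ℂ (u n) * u (n + 1))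
      rw [norm_mul, RCLike.norm_conj] at this
      exact (abs_le.1 this).1
    have h2 : -(‖u n‖ ^ 2 + ‖u (n + 1)‖ ^ 2) ≤ 2 * (starRingEnd ℂ (u n) * u (n + 1)).re := by
      nlinarith [sq_nonneg (‖u n‖ - ‖u (n + 1)‖)]
    have h3 := mul_le_mul_of_nonneg_left h2 (hb n)
    change _ ≤ a n * ‖u n‖ ^ 2 + 2 * (b n * (starRingEnd ℂ (u n) * u (n + 1)).re)
    linarith
  have hcoef : ∀ n, u n ≠ 0 → 0 < a n - b n - Nat.casesOn n 0 fun k => b k := fun n hn => by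
    cases n with
    | zero =>
      have := h0 fun hw => hn (by simp [hu, hw])
      simpa using this
    | succ n =>
      have := hS n
      simp only
      linarith
  have hg0 : ∀ n, 0 ≤ g n := fun n => by
    by_cases hn : u n = 0
    · simp [hg, hn]
    · exact mul_nonneg (hcoef n hn).le (by positivity)
  refine ⟨(tsum_nonneg hg0).trans hle, fun hQ n => ?_⟩
  have hz : ∑' n, g n = 0 := le_antisymm (hle.trans hQ.le) (tsum_nonneg hg0)
  have hgn : g n = 0 := congr_fun ((hasSum_zero_iff_of_nonneg hg0).1 (hz ▸ hgsum.summable.hasSum)) n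
  by_contra hn
  have : 0 < g n := mul_pos (hcoef n hn) (by have := norm_pos_iff.2 hn; positivity)
  exact this.ne' hgn

-- Every entry in column `n` carries the factor `w n`, so `W c = 0` already gives `T c = 0`.
omit hc in
lemma IsFactored.eigenvalue_eq_zero (hc' : c ∈ M.op.domain) (hc0 : c ≠ 0) {z : ℂ}
    (hz : M.op ⟨c, hc'⟩ = z • c) (hu : ∀ n, (w n : ℂ) * c n = 0) : z = 0 := by
  have h0 : M.op ⟨c, hc'⟩ = 0 := by
    ext n
    rw [M.op_apply]
    have h1 : ∀ x : ℝ, ∀ n, ((x * w n : ℝ) : ℂ) * c n = 0 := fun x n => by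
      rw [Complex.ofReal_mul, mul_assoc, hu, mul_zero]
    cases n with
    | zero => simp only [subSeq, diagSeq, supSeq, h.diag_eq, h.sup_eq, h1]; simp
    | succ n => simp only [subSeq, diagSeq, supSeq, h.diag_eq, h.sup_eq, h.sub_eq, h1]; simp
  rw [h0] at hz
  exact (smul_eq_zero.1 hz.symm).resolve_right hc0

lemma IsFactored.weight_mul_eq_zero (hw : ∀ n, 0 ≤ w n) (hN : ∑' n, w n * ‖c n‖ ^ 2 = 0) (n : ℕ) :
    (w n : ℂ) * c n = 0 := by
  have h1 := congr_fun ((hasSum_zero_iff_of_nonneg fun n =>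
    mul_nonneg (hw n) (sq_nonneg ‖c n‖)).1 (hN ▸ (h.summable_weight hc).hasSum)) n
  rcases mul_eq_zero.1 h1 with h2 | h2
  · simp [h2]
  · rw [norm_eq_zero.1 (pow_eq_zero_iff two_ne_zero |>.1 h2), mul_zero]

end Summability

lemma eq_div_of_ofReal {z : ℂ} {N Q : ℝ} (h : z * (N : ℂ) = (Q : ℂ)) (hN : N ≠ 0) :
    z = ((Q / N : ℝ) : ℂ) := by
  rw [Complex.ofReal_div, eq_div_iff (by exact_mod_cast hN), h]

/-- With a nonnegative weight, the eigenvalues are real. -/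
theorem IsFactored.im_eq_zero_of_nonneg (h : M.IsFactored w a b C) (hw : ∀ n, 0 ≤ w n) {z : ℂ}
    (hz : z ∈ eigenvalues M.op) : z.im = 0 := by
  obtain ⟨⟨c, hc⟩, hc0, hz⟩ := hz
  have key := h.mul_tsum_weight_eq hc hc hz
  by_cases hN : ∑' n, w n * ‖c n‖ ^ 2 = 0
  · rw [h.eigenvalue_eq_zero hc hc0 hz (h.weight_mul_eq_zero hc hw hN), Complex.zero_im]
  · rw [eq_div_of_ofReal key hN, Complex.ofReal_im]

/-- With a diagonally dominant symmetric factor, the eigenvalues are real. -/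
theorem IsFactored.im_eq_zero_of_dominant (h : M.IsFactored w a b C) (hb : ∀ n, 0 ≤ b n)
    (h0 : w 0 ≠ 0 → b 0 < a 0) (hS : ∀ n, b n + b (n + 1) < a (n + 1)) {z : ℂ}
    (hz : z ∈ eigenvalues M.op) : z.im = 0 := by
  obtain ⟨⟨c, hc⟩, hc0, hz⟩ := hz
  have key := h.mul_tsum_weight_eq hc hc hz
  by_cases hN : ∑' n, w n * ‖c n‖ ^ 2 = 0
  · rw [hN, Complex.ofReal_zero, mul_zero] at key
    rw [h.eigenvalue_eq_zero hc hc0 hz ((h.quadTerm_definite hc hb h0 hS).2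
      (by exact_mod_cast key.symm)), Complex.zero_im]
  · rw [eq_div_of_ofReal key hN, Complex.ofReal_im]

/-- With a nonnegative weight and a diagonally dominant symmetric factor, the eigenvalues are
nonnegative. -/
theorem IsFactored.re_nonneg (h : M.IsFactored w a b C) (hw : ∀ n, 0 ≤ w n) (hb : ∀ n, 0 ≤ b n)
    (h0 : w 0 ≠ 0 → b 0 < a 0) (hS : ∀ n, b n + b (n + 1) < a (n + 1)) {z : ℂ}
    (hz : z ∈ eigenvalues M.op) : 0 ≤ z.re := by
  obtain ⟨⟨c, hc⟩, hc0, hz⟩ := hz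
  have key := h.mul_tsum_weight_eq hc hc hz
  by_cases hN : ∑' n, w n * ‖c n‖ ^ 2 = 0
  · rw [h.eigenvalue_eq_zero hc hc0 hz (h.weight_mul_eq_zero hc hw hN), Complex.zero_re]
  · rw [eq_div_of_ofReal key hN, Complex.ofReal_re]
    exact div_nonneg (h.quadTerm_definite hc hb h0 hS).1
      (tsum_nonneg fun n => mul_nonneg (hw n) (sq_nonneg _))

end TridiagMatrix

/-! ### The operators of the Heun equation -/

/-- The expansions at infinity are those at zero with `A` replaced by `-A`, which is why the lemmas
on the latter allow `A` of either sign where possible. -/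
lemma matInftyMinus_eq (A m : ℝ) : matInftyMinus A m = matOMinus (-A) m := by
  simp only [matInftyMinus, matOMinus, TridiagMatrix.mk.injEq]
  refine ⟨?_, ?_, ?_⟩ <;> funext n <;> ring

lemma matInftyPlus_eq (A m : ℝ) : matInftyPlus A m = matOPlus (-A) m := by
  simp only [matInftyPlus, matOPlus, TridiagMatrix.mk.injEq]
  refine ⟨?_, ?_, ?_⟩ <;> funext n <;> ring

/-- A coefficient of modulus at most one times an affine function of `n`. -/
lemma abs_mul_affine_le {s x y C : ℝ} (hs : |s| ≤ 1) (hx : |x| ≤ C) (hy : |y| ≤ C) (n : ℕ) :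
    |s * (x * n + y)| ≤ C * ((n : ℝ) + 1) := by
  have hn : (0 : ℝ) ≤ n := Nat.cast_nonneg n
  rw [abs_mul]
  refine (mul_le_of_le_one_left (abs_nonneg _) hs).trans ((abs_add_le _ _).trans ?_)
  rw [abs_mul, abs_of_nonneg hn]
  nlinarith

section Heun

variable {m : ℝ} (hm0 : 0 < m) (hm1 : m < 1)

include hm0 hm1

/-- The leading coefficients are `m` and `4 - 2m`; the condition `2m < 4 - 2m` is exactly `m < 1`.
-/
lemma exists_dominatedAt_matOMinus (A : ℝ) : ∃ z q κ, (matOMinus A m).DominatedAt z q κ := by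
  have hA := abs_nonneg A
  have h1 := neg_abs_le A
  have h2 := le_abs_self A
  refine (matOMinus A m).exists_dominatedAt (α := m) (δ := 4 - 2 * m) (L := 4 + 4 * |A|)
    hm0.le (by linarith) (by positivity) (fun n => ?_) (fun n => ?_) (fun n => ?_)
  · have := abs_mul_affine_le (s := m / 2) (x := 2 * A + 1) (y := 0) (C := 4 + 4 * |A|)
      (by rw [abs_le]; constructor <;> linarith) (by rw [abs_le]; constructor <;> linarith)
      (by simp; positivity) n
    have e : (matOMinus A m).sub (n + 1) = m * (n : ℝ) ^ 2 + m / 2 * ((2 * A + 1) * n + 0) := by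
      simp only [matOMinus]; push_cast; ring
    rw [e]
    refine (abs_add_le _ _).trans (add_le_add (abs_of_nonneg (by positivity)).le this)
  · have := abs_mul_affine_le (s := m / 2) (x := 2 * A + 3) (y := 2 * A + 1)
      (C := 4 + 4 * |A|)
      (by rw [abs_le]; constructor <;> linarith) (by rw [abs_le]; constructor <;> linarith)
      (by rw [abs_le]; constructor <;> linarith) n
    have e : (matOMinus A m).sup n =
        m * (n : ℝ) ^ 2 + m / 2 * ((2 * A + 3) * n + (2 * A + 1)) := by
      simp only [matOMinus]; ring
    rw [e]
    refine (abs_add_le _ _).trans (add_le_add (abs_of_nonneg (by positivity)).le this)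
  · have := abs_mul_affine_le (s := 1 - m / 2) (x := 4 * A) (y := 0) (C := 4 + 4 * |A|)
      (by rw [abs_le]; constructor <;> linarith) (by rw [abs_le]; constructor <;> linarith)
      (by simp; positivity) n
    have e : (matOMinus A m).diag n =
        (4 - 2 * m) * (n : ℝ) ^ 2 + (1 - m / 2) * (4 * A * n + 0) := by
      simp only [matOMinus]; ring
    rw [e]
    linarith [(abs_le.1 this).1]

lemma exists_dominatedAt_matOPlus (A : ℝ) : ∃ z q κ, (matOPlus A m).DominatedAt z q κ := by
  have hA := abs_nonneg A
  have h1 := neg_abs_le A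
  have h2 := le_abs_self A
  refine (matOPlus A m).exists_dominatedAt (α := m) (δ := 4 - 2 * m) (L := 5 + 4 * |A|)
    hm0.le (by linarith) (by positivity) (fun n => ?_) (fun n => ?_) (fun n => ?_)
  · have := abs_mul_affine_le (s := m / 2) (x := 3 - 2 * A) (y := 1 - 2 * A)
      (C := 5 + 4 * |A|)
      (by rw [abs_le]; constructor <;> linarith) (by rw [abs_le]; constructor <;> linarith)
      (by rw [abs_le]; constructor <;> linarith) n
    have e : (matOPlus A m).sub (n + 1) =
        m * (n : ℝ) ^ 2 + m / 2 * ((3 - 2 * A) * n + (1 - 2 * A)) := by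
      simp only [matOPlus]; push_cast; ring
    rw [e]
    refine (abs_add_le _ _).trans (add_le_add (abs_of_nonneg (by positivity)).le this)
  · have := abs_mul_affine_le (s := m / 2) (x := 5 - 2 * A) (y := 3 - 2 * A)
      (C := 5 + 4 * |A|)
      (by rw [abs_le]; constructor <;> linarith) (by rw [abs_le]; constructor <;> linarith)
      (by rw [abs_le]; constructor <;> linarith) n
    have e : (matOPlus A m).sup n =
        m * (n : ℝ) ^ 2 + m / 2 * ((5 - 2 * A) * n + (3 - 2 * A)) := by
      simp only [matOPlus]; ring
    rw [e]
    refine (abs_add_le _ _).trans (add_le_add (abs_of_nonneg (by positivity)).le this)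
  · have := abs_mul_affine_le (s := 1 - m / 2) (x := 4 - 4 * A) (y := 1 - 2 * A)
      (C := 5 + 4 * |A|)
      (by rw [abs_le]; constructor <;> linarith) (by rw [abs_le]; constructor <;> linarith)
      (by rw [abs_le]; constructor <;> linarith) n
    have e : (matOPlus A m).diag n =
        (4 - 2 * m) * (n : ℝ) ^ 2 + (1 - m / 2) * ((4 - 4 * A) * n + (1 - 2 * A)) := by
      simp only [matOPlus]; ring
    rw [e]
    linarith [(abs_le.1 this).1]

lemma isFactored_matOMinus (A : ℝ) :
    (matOMinus A m).IsFactored (fun n => n) (fun n => (1 - m / 2) * (4 * n + 4 * A))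
      (fun n => m / 2 * (2 * n + (2 * A + 1))) (4 + 4 * |A|) := by
  have hA := abs_nonneg A
  have h1 := neg_abs_le A
  have h2 := le_abs_self A
  refine ⟨fun n => ?_, fun n => ?_, fun n => ?_, fun n => ?_, fun n => ?_, fun n => ?_⟩
  · simp only [matOMinus]; push_cast; ring
  · simp only [matOMinus]; ring
  · simp only [matOMinus]; push_cast; ring
  · rw [abs_of_nonneg (Nat.cast_nonneg n)]
    nlinarith [(Nat.cast_nonneg n : (0 : ℝ) ≤ n)]
  all_goals
    exact abs_mul_affine_le (by rw [abs_le]; constructor <;> linarith)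
      (by rw [abs_le]; constructor <;> linarith) (by rw [abs_le]; constructor <;> linarith) n

/-- The weight `2n + 1 - 2A` is negative at small `n` when `A > 1/2`, so reality rests on the
symmetric factor. The factors `1 *` fit the shape of `abs_mul_affine_le`. -/
lemma isFactored_matOPlus (A : ℝ) :
    (matOPlus A m).IsFactored (fun n => 1 * (2 * n + (1 - 2 * A)))
      (fun n => (1 - m / 2) * (2 * n + 1)) (fun n => m / 2 * (1 * n + 1)) (4 + 4 * |A|) := by
  have hA := abs_nonneg A
  have h1 := neg_abs_le A
  have h2 := le_abs_self A
  refine ⟨fun n => ?_, fun n => ?_, fun n => ?_, fun n => ?_, fun n => ?_, fun n => ?_⟩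
  · simp only [matOPlus]; push_cast; ring
  · simp only [matOPlus]; ring
  · simp only [matOPlus]; push_cast; ring
  all_goals
    exact abs_mul_affine_le (by rw [abs_le]; constructor <;> linarith)
      (by rw [abs_le]; constructor <;> linarith) (by rw [abs_le]; constructor <;> linarith) n

lemma matOMinus_im_eq_zero (A : ℝ) {z : ℂ} (hz : z ∈ eigenvalues (matOMinus A m).op) :
    z.im = 0 :=
  (isFactored_matOMinus hm0 hm1 A).im_eq_zero_of_nonneg (fun n => Nat.cast_nonneg n) hz

lemma matOPlus_im_eq_zero (A : ℝ) {z : ℂ} (hz : z ∈ eigenvalues (matOPlus A m).op) :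
    z.im = 0 := by
  -- The dominance margin `a_{n+1} - b_n - b_{n+1}` equals `(1 - m)(2n + 3)`, independently of `A`.
  refine (isFactored_matOPlus hm0 hm1 A).im_eq_zero_of_dominant (fun n => by positivity)
    (fun _ => ?_) (fun n => ?_) hz
  · norm_num; linarith
  · push_cast
    nlinarith [(Nat.cast_nonneg n : (0 : ℝ) ≤ n)]

lemma matOMinus_re_nonneg {A : ℝ} (hA : 0 < A) {z : ℂ}
    (hz : z ∈ eigenvalues (matOMinus A m).op) : 0 ≤ z.re := by
  -- Here `b 0 < a 0` can fail for small `A`, but `w 0 = 0` makes that condition void. In the later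
  -- rows the margin is `(1 - m)(4n + 4 + 4A)`.
  refine (isFactored_matOMinus hm0 hm1 A).re_nonneg (fun n => Nat.cast_nonneg n)
    (fun n => by positivity) (fun hw => by simp at hw) (fun n => ?_) hz
  push_cast
  nlinarith [mul_nonneg (Nat.cast_nonneg n : (0 : ℝ) ≤ n) (sub_nonneg.2 hm1.le),
    mul_pos hA (sub_pos.2 hm1)]

lemma matOPlus_re_nonneg {A : ℝ} (hA : A < 0) {z : ℂ}
    (hz : z ∈ eigenvalues (matOPlus A m).op) : 0 ≤ z.re := by
  -- For `A < 0` the weight `2n + 1 - 2A` is positive, so both sides of the pairing identity have a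
  -- sign.
  refine (isFactored_matOPlus hm0 hm1 A).re_nonneg
    (fun n => by linarith [(Nat.cast_nonneg n : (0 : ℝ) ≤ n)]) (fun n => by positivity)
    (fun _ => ?_) (fun n => ?_) hz
  · norm_num; linarith
  · push_cast
    nlinarith [(Nat.cast_nonneg n : (0 : ℝ) ≤ n)]

end Heun

end HeunTridiagonal

end

theorem lemmal (A m : ℝ) (hA : 0 < A) (hm0 : 0 < m) (hm1 : m < 1) :
    (∀ M ∈ ({HeunTridiagonal.matOMinus A m, HeunTridiagonal.matOPlus A m,
          HeunTridiagonal.matInftyMinus A m, HeunTridiagonal.matInftyPlus A m} :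
          Set HeunTridiagonal.TridiagMatrix),
        (M.op.IsClosed ∧ HeunTridiagonal.HasCompactResolvent M.op) ∧
        HeunTridiagonal.ConvergesGeneralized M.truncOp M.op ∧
        ∀ z ∈ HeunTridiagonal.eigenvalues M.op, z.im = 0) ∧
    ∀ z ∈ HeunTridiagonal.eigenvalues (HeunTridiagonal.matOMinus A m).op ∪
        HeunTridiagonal.eigenvalues (HeunTridiagonal.matInftyPlus A m).op,
      z.im = 0 ∧ 0 ≤ z.re := by
  open HeunTridiagonal in
  have hMinus : ∀ B : ℝ, ((matOMinus B m).op.IsClosed ∧ HasCompactResolvent (matOMinus B m).op) ∧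
      ConvergesGeneralized (matOMinus B m).truncOp (matOMinus B m).op ∧
      ∀ z ∈ eigenvalues (matOMinus B m).op, z.im = 0 := fun B => by
    obtain ⟨z, q, κ, h⟩ := exists_dominatedAt_matOMinus hm0 hm1 B
    have := h.closed_compactResolvent_convergesGeneralized
    exact ⟨this.1, this.2, fun z hz => matOMinus_im_eq_zero hm0 hm1 B hz⟩
  open HeunTridiagonal in
  have hPlus : ∀ B : ℝ, ((matOPlus B m).op.IsClosed ∧ HasCompactResolvent (matOPlus B m).op) ∧
      ConvergesGeneralized (matOPlus B m).truncOp (matOPlus B m).op ∧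
      ∀ z ∈ eigenvalues (matOPlus B m).op, z.im = 0 := fun B => by
    obtain ⟨z, q, κ, h⟩ := exists_dominatedAt_matOPlus hm0 hm1 B
    have := h.closed_compactResolvent_convergesGeneralized
    exact ⟨this.1, this.2, fun z hz => matOPlus_im_eq_zero hm0 hm1 B hz⟩
  refine ⟨?_, ?_⟩
  · rintro M (rfl | rfl | rfl | rfl)
    · exact hMinus A
    · exact hPlus A
    · rw [HeunTridiagonal.matInftyMinus_eq]; exact hMinus (-A)
    · rw [HeunTridiagonal.matInftyPlus_eq]; exact hPlus (-A)
  · rintro z (hz | hz)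
    · exact ⟨HeunTridiagonal.matOMinus_im_eq_zero hm0 hm1 A hz,
        HeunTridiagonal.matOMinus_re_nonneg hm0 hm1 hA hz⟩
    · rw [HeunTridiagonal.matInftyPlus_eq] at hz
      exact ⟨HeunTridiagonal.matOPlus_im_eq_zero hm0 hm1 (-A) hz,
        HeunTridiagonal.matOPlus_re_nonneg hm0 hm1 (neg_lt_zero.2 hA) hz⟩
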